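/- Let $B_l$ be the Bernoulli numbers, $\frac{x}{e^x-1}=\sum_{l\ge 0}\frac{B_l}{l!}x^l$ (so $B_1=-\tfrac12$), and let $S_k^{(1)}(l)$ be the (signed) Stirling numbers of the first kind, defined by $$x(x+1)\cdots(x+k-1)=(-1)^k\sum_{l=0}^{k}(-1)^l S_k^{(1)}(l)\,x^l .$$ For $k\ge 1$ put $$a_k=(-1)^{k+1}\sum_{l=1}^{k}(-1)^l\frac{(2l+1)!!}{2^{l+1}(l+1)!}B_{l+1}S_k^{(1)}(l),\qquad b_k=(-1)^{k+1}\sum_{l=1}^{k}(-1)^l\frac{(2l-1)!!}{2^{l}\,l!}B_{l}S_k^{(1)}(l).$$ Then for every natural number $n\ge 1$ the two series below converge absolutely, and $$\sum_{k=1}^{n}\frac{1}{k\sqrt{k}}=\zeta\!\left(\tfrac32\right)-\frac{2}{\sqrt n}+\frac{1}{2n\sqrt n}+\frac{2}{\sqrt n}\sum_{k=1}^{\infty}\frac{a_k}{n(n+1)(n+2)\cdots(n+k)}$$ and $$\sum_{k=1}^{n}\frac{1}{k\sqrt{k}}=\zeta\!\left(\tfrac32\right)-\frac{2}{\sqrt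 n}+2\sum_{k=1}^{\infty}\frac{b_k}{\sqrt n\,(n+1)(n+2)\cdots(n+k)} .$$ The first coefficients are $2a_1=-\frac18$, $2a_2=-\frac18$, $2a_3=-\frac{89}{384}$, $2a_4=-\frac{41}{64}$ and $2b_1=\frac12$, $2b_2=\frac38$, $2b_3=\frac58$, $2b_4=\frac{631}{384}$. -/

import Mathlib

open scoped Nat

/-- The (signed) Stirling number of the first kind `S_k^{(1)}(l)`, where
`x (x+1) ⋯ (x+k-1) = (-1)^k ∑_{l=0}^k (-1)^l S_k^{(1)}(l) x^l`
(see `prod_eq_sum_stirlingFirstSigned`). -/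
def stirlingFirstSigned (k l : ℕ) : ℤ :=
  (-1) ^ (k + l) * (Nat.stirlingFirst k l : ℤ)

theorem sum_stirlingFirst_mul_pow {R : Type*} [CommRing R] (k : ℕ) (x : R) :
    ∑ l ∈ Finset.range (k + 1), (Nat.stirlingFirst k l : R) * x ^ l =
      ∏ i ∈ Finset.range k, (x + (i : R)) := by
  induction k with
  | zero => simp
  | succ k ih =>
    have h : ∑ l ∈ Finset.range (k + 1), (Nat.stirlingFirst k (l + 1) : R) * x ^ (l + 1) * (k : R) =
        (∑ l ∈ Finset.range (k + 1), (Nat.stirlingFirst k l : R) * x ^ l) * (k : R) := by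
      rw [← Finset.sum_mul, Finset.sum_range_succ,
        Finset.sum_range_succ' (fun l => (Nat.stirlingFirst k l : R) * x ^ l)]
      rw [Nat.stirlingFirst_eq_zero_of_lt (Nat.lt_succ_self k)]
      cases k <;> simp [add_mul]
    rw [Finset.prod_range_succ, ← ih, mul_add, ← h, Finset.sum_range_succ', Finset.sum_mul,
      ← Finset.sum_add_distrib]
    simp only [Nat.stirlingFirst_succ_zero, Nat.cast_zero, zero_mul, add_zero]
    refine Finset.sum_congr rfl fun l _ => ?_
    rw [Nat.stirlingFirst_succ_succ]
    push_cast
    ring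

/-- The identity that characterises the signed Stirling numbers of the first kind. -/
theorem prod_eq_sum_stirlingFirstSigned {R : Type*} [CommRing R] (k : ℕ) (x : R) :
    ∏ i ∈ Finset.range k, (x + (i : R)) =
      (-1) ^ k * ∑ l ∈ Finset.range (k + 1),
        (-1) ^ l * ((stirlingFirstSigned k l : ℤ) : R) * x ^ l := by
  rw [← sum_stirlingFirst_mul_pow, Finset.mul_sum]
  refine Finset.sum_congr rfl fun l _ => ?_
  have h1 : ((-1 : R) ^ k) * (-1) ^ k = 1 := by rw [← mul_pow]; simp
  have h2 : ((-1 : R) ^ l) * (-1) ^ l = 1 := by rw [← mul_pow]; simp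
  simp only [stirlingFirstSigned, Int.cast_mul, Int.cast_pow, Int.cast_neg, Int.cast_one,
    Int.cast_natCast, pow_add]
  linear_combination (-(Nat.stirlingFirst k l : R) * x ^ l * (-1) ^ k * (-1) ^ k) * h2 -
    (Nat.stirlingFirst k l : R) * x ^ l * h1

/-- `(-1)^{k+1} ∑_{l=1}^k (-1)^l (2l+1)!! / (2^{l+1} (l+1)!) B_{l+1} S_k^{(1)}(l)`,
with `B_1 = -1/2`. -/
def zetaThreeHalvesCoeffA (k : ℕ) : ℚ :=
  (-1) ^ (k + 1) * ∑ l ∈ Finset.Icc 1 k,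
    (-1) ^ l * (((2 * l + 1)‼ : ℚ) / (2 ^ (l + 1) * ((l + 1)! : ℚ))) *
      bernoulli (l + 1) * (stirlingFirstSigned k l : ℚ)

/-- `(-1)^{k+1} ∑_{l=1}^k (-1)^l (2l-1)!! / (2^l l!) B_l S_k^{(1)}(l)`, with `B_1 = -1/2`. -/
def zetaThreeHalvesCoeffB (k : ℕ) : ℚ :=
  (-1) ^ (k + 1) * ∑ l ∈ Finset.Icc 1 k,
    (-1) ^ l * (((2 * l - 1)‼ : ℚ) / (2 ^ l * (l ! : ℚ))) *
      bernoulli l * (stirlingFirstSigned k l : ℚ)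

/-- The term of index `k` of the first series:
`zetaThreeHalvesCoeffA k / (n (n+1) (n+2) ⋯ (n+k))`. -/
noncomputable def zetaThreeHalvesTermA (n k : ℕ) : ℝ :=
  (zetaThreeHalvesCoeffA k : ℝ) / ((n : ℝ) * ∏ i ∈ Finset.Icc 1 k, ((n : ℝ) + (i : ℝ)))

/-- The term of index `k` of the second series:
`zetaThreeHalvesCoeffB k / (√n (n+1) (n+2) ⋯ (n+k))`. -/
noncomputable def zetaThreeHalvesTermB (n k : ℕ) : ℝ :=
  (zetaThreeHalvesCoeffB k : ℝ) / (√(n : ℝ) * ∏ i ∈ Finset.Icc 1 k, ((n : ℝ) + (i : ℝ)))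

/-! Fix 0 < s ≤ 1 and put x = 1 - e^{-t}, so that v = -s log(1-x) = st. Expanding v/(e^v - 1) in
powers of x gives coefficients β_k(s) = `bernoulliLogCoeff s k`, which are Stirling sums of B_l s^l.
Its Laplace transform at a ≥ 1 can be computed in two ways: the powers of x give Σ β_k(s)
k!/(a(a+1)⋯(a+k)), and the geometric series in e^{-v} gives Σ_{m≥1} s/(a+ms)²
(`hasSum_bernoulliLogCoeff_mul_invFactorialTerm`).

Now average over s = sin²θ, θ in [0, π]. The power s^l becomes (2l-1)!!/(2^l l!), and s/(n+ms)²
becomes 1/(2√n (n+m)^{3/2}) (`integral_sin_sq_div_sq`). The right side is then the tail of ζ(3/2),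
and the left side is, up to the factor -√n, the b-series together with its k = 0 term. The a-series
follows by summation by parts: its coefficients come from applying (1-x) d/dx.

The analytic work is to justify the interchanges and the limit in the boundary term. Up to s/k,
β_k(s) is the coefficient u_k of v/(1 - e^{-v}). These u_k are nonnegative, since the reciprocal
series has nonpositive higher coefficients, and nonincreasing, by Kaluza's theorem. Positivity and
v/(1 - e^{-v}) ≤ 1 + v bound Σ u_k/(k+1), hence absolute convergence; monotonicity then gives decay
of the averages and absolute convergence of the a-series. -/

open MeasureTheory

/-! ### Stirling numbers and substitution of -log(1-X) -/

/-- The power series `-log (1 - X) = ∑ X^k / k`. -/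
noncomputable def negLogOneSub : PowerSeries ℝ := PowerSeries.mk fun k => ((k : ℝ))⁻¹

/-- The coefficients `(1 / k!) ∑_l c(k, l) h_l` of the series obtained by substituting
`-log (1 - x)` in the exponential generating function of `h`. -/
noncomputable def stirlingTransform (h : ℕ → ℝ) (k : ℕ) : ℝ :=
  (∑ l ∈ Finset.range (k + 1), (Nat.stirlingFirst k l : ℝ) * h l) / (k ! : ℝ)

theorem constantCoeff_negLogOneSub : PowerSeries.constantCoeff negLogOneSub = 0 := by
  simp [negLogOneSub, ← PowerSeries.coeff_zero_eq_constantCoeff_apply]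

theorem hasSubst_negLogOneSub : PowerSeries.HasSubst negLogOneSub :=
  PowerSeries.HasSubst.of_constantCoeff_zero' constantCoeff_negLogOneSub

theorem one_sub_X_mul_derivative_negLogOneSub :
    (1 - PowerSeries.X) * PowerSeries.derivative ℝ negLogOneSub = 1 := by
  ext k
  rw [sub_mul, one_mul, map_sub, PowerSeries.coeff_derivative, PowerSeries.coeff_one]
  rcases k with _ | k
  · simp [negLogOneSub]
  · rw [PowerSeries.coeff_succ_X_mul, PowerSeries.coeff_derivative]
    simp only [negLogOneSub, PowerSeries.coeff_mk]
    push_cast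
    have h1 : ((k : ℝ) + 1) ≠ 0 := by positivity
    have h2 : ((k : ℝ) + 1 + 1) ≠ 0 := by positivity
    simp [h1, h2]

/-- Since (1-X)L' = 1 for L = -log(1-X), one has (1-X)(L^{l+1})' = (l+1)L^l. Comparing coefficients
gives the Stirling recurrence up to factorials. -/
theorem coeff_negLogOneSub_pow_succ (k l : ℕ) :
    ((k : ℝ) + 1) * PowerSeries.coeff (k + 1) (negLogOneSub ^ (l + 1)) =
      k * PowerSeries.coeff k (negLogOneSub ^ (l + 1)) +
        (l + 1) * PowerSeries.coeff k (negLogOneSub ^ l) := by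
  have h : (1 - PowerSeries.X) * PowerSeries.derivative ℝ (negLogOneSub ^ (l + 1)) =
      (l + 1 : ℝ) • negLogOneSub ^ l := by
    rw [Derivation.leibniz_pow, Nat.add_sub_cancel, mul_smul_comm, smul_eq_mul, mul_left_comm,
      one_sub_X_mul_derivative_negLogOneSub, mul_one, ← Nat.cast_smul_eq_nsmul ℝ]
    push_cast
    rfl
  have h2 := congrArg (PowerSeries.coeff k) h
  rw [sub_mul, one_mul, map_sub, PowerSeries.coeff_derivative, PowerSeries.coeff_smul] at h2
  rcases k with _ | k
  · simp at h2 ⊢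
    linarith
  · rw [PowerSeries.coeff_succ_X_mul, PowerSeries.coeff_derivative] at h2
    push_cast at h2 ⊢
    simp only [smul_eq_mul] at h2
    linarith

theorem coeff_negLogOneSub_pow (k l : ℕ) :
    PowerSeries.coeff k (negLogOneSub ^ l) = (l ! : ℝ) * Nat.stirlingFirst k l / (k ! : ℝ) := by
  induction k generalizing l with
  | zero =>
    rcases l with _ | l
    · simp
    · simp [PowerSeries.coeff_zero_eq_constantCoeff_apply, constantCoeff_negLogOneSub]
  | succ k ih =>
    rcases l with _ | l
    · simp [PowerSeries.coeff_one]
    · have h := coeff_negLogOneSub_pow_succ k l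
      rw [ih, ih] at h
      have h1 : ((k : ℝ) + 1) ≠ 0 := by positivity
      have h2 : (k ! : ℝ) ≠ 0 := by positivity
      apply mul_left_cancel₀ h1
      rw [h, Nat.stirlingFirst_succ_succ, Nat.factorial_succ k, Nat.factorial_succ l]
      push_cast
      field_simp

theorem coeff_subst_negLogOneSub (f : PowerSeries ℝ) (k : ℕ) :
    PowerSeries.coeff k (f.subst negLogOneSub) =
      stirlingTransform (fun l => (l ! : ℝ) * PowerSeries.coeff l f) k := by
  rw [PowerSeries.coeff_subst' hasSubst_negLogOneSub, finsum_eq_sum_of_support_subset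
    (s := Finset.range (k + 1)), stirlingTransform, Finset.sum_div]
  · refine Finset.sum_congr rfl fun l _ => ?_
    rw [coeff_negLogOneSub_pow, smul_eq_mul]
    ring
  · intro l hl
    by_contra h
    simp only [Finset.coe_range, Set.mem_Iio, not_lt] at h
    apply hl
    simp only
    rw [coeff_negLogOneSub_pow, Nat.stirlingFirst_eq_zero_of_lt (by omega)]
    simp

/-! ### The Todd series at -s log(1-x) and its reciprocal -/

/-- The power series `(1 - e^{-X}) / X`. -/
noncomputable def oneSubExpNegDiv : PowerSeries ℝ :=
  PowerSeries.mk fun l => (-1) ^ l / ((l + 1)! : ℝ)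

theorem bernoulli'PowerSeries_mul_oneSubExpNegDiv :
    bernoulli'PowerSeries ℝ * oneSubExpNegDiv = 1 := by
  have h1 := bernoulli'PowerSeries_mul_exp_sub_one ℝ
  have h2 : PowerSeries.X * oneSubExpNegDiv = 1 - PowerSeries.evalNegHom (PowerSeries.exp ℝ) := by
    ext k
    rcases k with _ | k
    · rw [PowerSeries.coeff_zero_X_mul, map_sub, PowerSeries.evalNegHom,
        PowerSeries.coeff_rescale]
      simp
    · rw [PowerSeries.coeff_succ_X_mul]
      simp [PowerSeries.evalNegHom, oneSubExpNegDiv, PowerSeries.coeff_one, PowerSeries.coeff_exp,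
        PowerSeries.coeff_rescale, pow_succ]
      ring
  have h3 := PowerSeries.exp_mul_exp_neg_eq_one (A := ℝ)
  apply mul_left_cancel₀ (PowerSeries.X_ne_zero (R := ℝ))
  linear_combination PowerSeries.evalNegHom (PowerSeries.exp ℝ) * h1 +
    bernoulli'PowerSeries ℝ * h2 + (PowerSeries.X - bernoulli'PowerSeries ℝ) * h3

/-- The coefficients in `x` of `v / (1 - e^{-v})` at `v = -s log (1 - x)`. -/
noncomputable def toddLogCoeff (s : ℝ) (k : ℕ) : ℝ :=
  stirlingTransform (fun l => (bernoulli' l : ℝ) * s ^ l) k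

/-- The coefficients in `x` of `(1 - e^{-v}) / v` at `v = -s log (1 - x)`. -/
noncomputable def invToddLogCoeff (s : ℝ) (k : ℕ) : ℝ :=
  stirlingTransform (fun l => (-s) ^ l / ((l : ℝ) + 1)) k

/-- Rescaling by s and substituting -log(1-X) are ring homomorphisms, so they preserve the
reciprocity of v/(1-e^{-v}) and (1-e^{-v})/v. -/
theorem mk_todd_mul_mk_invTodd (s : ℝ) :
    PowerSeries.mk (toddLogCoeff s) * PowerSeries.mk (invToddLogCoeff s) = 1 := by
  have h1 : PowerSeries.mk (toddLogCoeff s) =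
      (PowerSeries.rescale s (bernoulli'PowerSeries ℝ)).subst negLogOneSub := by
    ext k
    rw [coeff_subst_negLogOneSub, PowerSeries.coeff_mk, toddLogCoeff]
    congr 1
    ext l
    have : (l ! : ℝ) ≠ 0 := by positivity
    simp [PowerSeries.coeff_rescale, bernoulli'PowerSeries]
    field_simp
  have h2 : PowerSeries.mk (invToddLogCoeff s) =
      (PowerSeries.rescale s oneSubExpNegDiv).subst negLogOneSub := by
    ext k
    rw [coeff_subst_negLogOneSub, PowerSeries.coeff_mk, invToddLogCoeff]
    congr 1
    ext l
    have : (l ! : ℝ) ≠ 0 := by positivity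
    rw [PowerSeries.coeff_rescale, oneSubExpNegDiv, PowerSeries.coeff_mk, Nat.factorial_succ,
      neg_pow]
    push_cast
    field_simp
  rw [h1, h2, ← PowerSeries.subst_mul hasSubst_negLogOneSub, ← map_mul,
    bernoulli'PowerSeries_mul_oneSubExpNegDiv, map_one]
  rw [← PowerSeries.coe_substAlgHom hasSubst_negLogOneSub, map_one]

/-! ### Signs of the coefficients of a reciprocal power series -/

theorem sum_antidiagonal_of_mk_mul_mk_eq_one {R : Type*} [CommRing R] {u q : ℕ → R}
    (h : PowerSeries.mk u * PowerSeries.mk q = 1) (k : ℕ) :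
    ∑ j ∈ Finset.range (k + 2), u j * q (k + 1 - j) = 0 := by
  have h1 := congrArg (PowerSeries.coeff (k + 1)) h
  rw [PowerSeries.coeff_mul, PowerSeries.coeff_one, if_neg (Nat.succ_ne_zero k),
    Finset.Nat.sum_antidiagonal_eq_sum_range_succ_mk] at h1
  simpa using h1

theorem mul_eq_one_of_mk_mul_mk_eq_one {R : Type*} [CommRing R] {u q : ℕ → R}
    (h : PowerSeries.mk u * PowerSeries.mk q = 1) : u 0 * q 0 = 1 := by
  have h1 := congrArg (PowerSeries.coeff 0) h
  rw [PowerSeries.coeff_mul] at h1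
  simpa using h1

/-- The renewal sequence of a nonnegative sequence is nonnegative. -/
theorem nonneg_of_mk_mul_mk_eq_one {u q : ℕ → ℝ} (h : PowerSeries.mk u * PowerSeries.mk q = 1)
    (hq0 : q 0 = 1) (hq : ∀ k, q (k + 1) ≤ 0) (k : ℕ) : 0 ≤ u k := by
  induction k using Nat.strong_induction_on with
  | _ k ih =>
    rcases k with _ | k
    · have := mul_eq_one_of_mk_mul_mk_eq_one h
      rw [hq0, mul_one] at this
      simp [this]
    · have h1 := sum_antidiagonal_of_mk_mul_mk_eq_one h k
      rw [Finset.sum_range_succ, Nat.sub_self, hq0, mul_one] at h1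
      have h2 : ∑ j ∈ Finset.range (k + 1), u j * q (k + 1 - j) ≤ 0 := by
        refine Finset.sum_nonpos fun j hj => ?_
        have hj := Finset.mem_range.1 hj
        have e : k + 1 - j = (k - j) + 1 := by omega
        rw [e]
        exact mul_nonpos_of_nonneg_of_nonpos (ih j hj) (hq _)
      linarith

/-- Log-convexity makes the ratios r(j+1)/r(j) nondecreasing; this is that monotonicity with
denominators cleared. -/
theorem mul_succ_le_of_log_convex {r : ℕ → ℝ} (hpos : ∀ k, 0 < r k)
    (hconv : ∀ k, r (k + 1) ^ 2 ≤ r k * r (k + 2)) (j d : ℕ) :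
    r (j + d) * r (j + 1) ≤ r (j + d + 1) * r j := by
  induction d with
  | zero => simp [mul_comm]
  | succ d ih =>
    have h1 := hconv (j + d)
    have p1 := hpos (j + d)
    have p2 := hpos (j + d + 1)
    have p3 := hpos j
    have e : r (j + (d + 1)) = r (j + d + 1) := rfl
    have e2 : r (j + (d + 1) + 1) = r (j + d + 2) := rfl
    rw [e, e2]
    refine le_of_mul_le_mul_left ?_ p1
    calc r (j + d) * (r (j + d + 1) * r (j + 1))
        = r (j + d + 1) * (r (j + d) * r (j + 1)) := by ring
      _ ≤ r (j + d + 1) * (r (j + d + 1) * r j) := mul_le_mul_of_nonneg_left ih p2.le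
      _ = r (j + d + 1) ^ 2 * r j := by ring
      _ ≤ r (j + d) * r (j + d + 2) * r j := mul_le_mul_of_nonneg_right h1 p3.le
      _ = _ := by ring

/-- **Kaluza's theorem**: the reciprocal of a power series with log-convex coefficients has
nonpositive coefficients in positive degree. -/
theorem nonpos_of_mk_mul_mk_eq_one_of_log_convex {w r : ℕ → ℝ}
    (h : PowerSeries.mk w * PowerSeries.mk r = 1) (hr0 : r 0 = 1) (hpos : ∀ k, 0 < r k)
    (hconv : ∀ k, r (k + 1) ^ 2 ≤ r k * r (k + 2)) (k : ℕ) : w (k + 1) ≤ 0 := by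
  have hw0 : w 0 = 1 := by
    have := mul_eq_one_of_mk_mul_mk_eq_one h
    rwa [hr0, mul_one] at this
  induction k using Nat.strong_induction_on with
  | _ k ih =>
    rcases k with _ | k
    · have h1 := sum_antidiagonal_of_mk_mul_mk_eq_one h 0
      simp [Finset.sum_range_succ, hw0, hr0] at h1
      have := hpos 1
      linarith
    · have h1 := sum_antidiagonal_of_mk_mul_mk_eq_one h (k + 1)
      have h2 := sum_antidiagonal_of_mk_mul_mk_eq_one h k
      rw [Finset.sum_range_succ, Nat.sub_self, hr0, mul_one] at h1
      -- A combination of the convolution identities in degrees k+2 and k+1, chosen so that the term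
      -- of w 0 = 1, the only positive coefficient, cancels. The remaining brackets are nonnegative
      -- by log-convexity.
      have h3 : w (k + 2) * r (k + 1) =
          ∑ j ∈ Finset.range (k + 2),
            w j * (r (k + 2) * r (k + 1 - j) - r (k + 1) * r (k + 2 - j)) := by
        have : ∑ j ∈ Finset.range (k + 2),
            w j * (r (k + 2) * r (k + 1 - j) - r (k + 1) * r (k + 2 - j)) =
            r (k + 2) * (∑ j ∈ Finset.range (k + 2), w j * r (k + 1 - j)) -
              r (k + 1) * ∑ j ∈ Finset.range (k + 2), w j * r (k + 1 + 1 - j) := by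
          rw [Finset.mul_sum, Finset.mul_sum, ← Finset.sum_sub_distrib]
          exact Finset.sum_congr rfl fun j _ => by ring
        rw [this, h2]
        linear_combination r (k + 1) * h1
      have h4 : w (k + 2) * r (k + 1) ≤ 0 := by
        rw [h3]
        refine Finset.sum_nonpos fun j hj => ?_
        have hj := Finset.mem_range.1 hj
        rcases j with _ | j
        · simp [mul_comm]
        · refine mul_nonpos_of_nonpos_of_nonneg (ih j (by omega)) (sub_nonneg.2 ?_)
          have h5 := mul_succ_le_of_log_convex hpos hconv (k - j) (j + 1)
          have e1 : k - j + (j + 1) = k + 1 := by omega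
          have e2 : k + 1 - (j + 1) = k - j := by omega
          have e3 : k + 2 - (j + 1) = k - j + 1 := by omega
          rw [e1] at h5
          rwa [e2, e3]
      exact nonpos_of_mul_nonpos_left h4 (hpos _)

/-! ### Positivity and monotonicity of the Todd coefficients -/

/-- As (1-e^{-V})/V = ∫₀¹ e^{-Vv} dv with V = -s log(1-x), the coefficients are averages over v of
the binomial coefficients of (1-x)^{sv}. -/
theorem invToddLogCoeff_eq_integral (s : ℝ) (k : ℕ) :
    invToddLogCoeff s k =
      ∫ v in (0 : ℝ)..1, (∏ i ∈ Finset.range k, ((i : ℝ) - s * v)) / (k ! : ℝ) := by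
  have h : ∀ v : ℝ, ∏ i ∈ Finset.range k, ((i : ℝ) - s * v) =
      ∑ l ∈ Finset.range (k + 1), (Nat.stirlingFirst k l : ℝ) * (-s) ^ l * v ^ l := by
    intro v
    have := sum_stirlingFirst_mul_pow k (-s * v)
    have e : ∏ i ∈ Finset.range k, ((i : ℝ) - s * v) = ∏ i ∈ Finset.range k, (-s * v + (i : ℝ)) :=
      Finset.prod_congr rfl fun i _ => by ring
    rw [e, ← this]
    exact Finset.sum_congr rfl fun l _ => by rw [mul_pow]; ring
  simp only [h]
  rw [intervalIntegral.integral_div, intervalIntegral.integral_finsetSum, invToddLogCoeff,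
    stirlingTransform]
  · congr 1
    refine Finset.sum_congr rfl fun l _ => ?_
    rw [intervalIntegral.integral_const_mul, integral_pow]
    simp
    ring
  · intro l _
    exact (by fun_prop : Continuous _).intervalIntegrable _ _

theorem invToddLogCoeff_zero (s : ℝ) : invToddLogCoeff s 0 = 1 := by
  simp [invToddLogCoeff, stirlingTransform]

theorem prod_succ_sub_nonneg {a : ℝ} (ha : a ≤ 1) (k : ℕ) :
    0 ≤ ∏ i ∈ Finset.range k, ((i : ℝ) + 1 - a) :=
  Finset.prod_nonneg fun i _ => by
    have : (0 : ℝ) ≤ i := Nat.cast_nonneg i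
    linarith

theorem prod_range_succ_sub (a : ℝ) (k : ℕ) :
    ∏ i ∈ Finset.range (k + 1), ((i : ℝ) - a) =
      -a * ∏ i ∈ Finset.range k, ((i : ℝ) + 1 - a) := by
  rw [Finset.prod_range_succ']
  push_cast
  ring

/-- For 0 ≤ sv ≤ 1 the factor with i = 0 is the only nonpositive one in the integrand. -/
theorem invToddLogCoeff_succ_nonpos {s : ℝ} (h0 : 0 ≤ s) (h1 : s ≤ 1) (k : ℕ) :
    invToddLogCoeff s (k + 1) ≤ 0 := by
  rw [invToddLogCoeff_eq_integral, ← neg_nonneg, ← intervalIntegral.integral_neg]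
  refine intervalIntegral.integral_nonneg zero_le_one fun v hv => ?_
  have hsv : 0 ≤ s * v := mul_nonneg h0 hv.1
  have hsv1 : s * v ≤ 1 := mul_le_one₀ h1 hv.1 hv.2
  rw [prod_range_succ_sub, ← neg_div]
  refine div_nonneg ?_ (by positivity)
  have := mul_nonneg hsv (prod_succ_sub_nonneg hsv1 k)
  linarith

theorem toddLogCoeff_nonneg {s : ℝ} (h0 : 0 ≤ s) (h1 : s ≤ 1) (k : ℕ) : 0 ≤ toddLogCoeff s k :=
  nonneg_of_mk_mul_mk_eq_one (mk_todd_mul_mk_invTodd s) (invToddLogCoeff_zero s)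
    (invToddLogCoeff_succ_nonpos h0 h1) k

/-- The partial sums of `invToddLogCoeff s`. -/
noncomputable def invToddLogSum (s : ℝ) (k : ℕ) : ℝ :=
  ∫ v in (0 : ℝ)..1, (∏ i ∈ Finset.range k, ((i : ℝ) + 1 - s * v)) / (k ! : ℝ)

theorem intervalIntegrable_prod_succ_sub (s : ℝ) (k : ℕ) :
    IntervalIntegrable (fun v => (∏ i ∈ Finset.range k, ((i : ℝ) + 1 - s * v)) / (k ! : ℝ))
      MeasureTheory.volume 0 1 :=
  (by fun_prop : Continuous _).intervalIntegrable _ _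

theorem invToddLogSum_zero (s : ℝ) : invToddLogSum s 0 = 1 := by simp [invToddLogSum]

theorem invToddLogSum_succ (s : ℝ) (k : ℕ) :
    invToddLogSum s (k + 1) = invToddLogSum s k + invToddLogCoeff s (k + 1) := by
  rw [invToddLogCoeff_eq_integral, invToddLogSum, invToddLogSum,
    ← intervalIntegral.integral_add (intervalIntegrable_prod_succ_sub s k)
      ((by fun_prop : Continuous _).intervalIntegrable _ _)]
  congr 1
  ext v
  have h1 : ((k : ℝ) + 1) ≠ 0 := by positivity
  have h2 : (k ! : ℝ) ≠ 0 := by positivity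
  rw [prod_range_succ_sub, Finset.prod_range_succ, Nat.factorial_succ]
  push_cast
  field_simp
  ring

theorem invToddLogSum_pos {s : ℝ} (h1 : s ≤ 1) (k : ℕ) : 0 < invToddLogSum s k := by
  refine intervalIntegral.intervalIntegral_pos_of_pos_on
    (intervalIntegrable_prod_succ_sub s k) (fun v hv => ?_) zero_lt_one
  refine div_pos (Finset.prod_pos fun i _ => ?_) (by positivity)
  have : (0 : ℝ) ≤ i := Nat.cast_nonneg i
  have : s * v ≤ v := mul_le_of_le_one_left hv.1.le h1
  have := hv.2
  linarith

/-- The integrands are log-convex in k for each v. Log-convexity survives integration because it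
amounts to nonnegativity of a quadratic form in x, read off at the end from the discriminant. -/
theorem invToddLogSum_log_convex {s : ℝ} (h0 : 0 ≤ s) (h1 : s ≤ 1) (k : ℕ) :
    invToddLogSum s (k + 1) ^ 2 ≤ invToddLogSum s k * invToddLogSum s (k + 2) := by
  have key : ∀ x : ℝ, 0 ≤ invToddLogSum s k * (x * x) + (2 * invToddLogSum s (k + 1)) * x +
      invToddLogSum s (k + 2) := by
    intro x
    have e : invToddLogSum s k * (x * x) + (2 * invToddLogSum s (k + 1)) * x +
        invToddLogSum s (k + 2) = ∫ v in (0 : ℝ)..1,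
          ((x * x) * ((∏ i ∈ Finset.range k, ((i : ℝ) + 1 - s * v)) / (k ! : ℝ)) +
          (2 * x) * ((∏ i ∈ Finset.range (k + 1), ((i : ℝ) + 1 - s * v)) / ((k + 1)! : ℝ)) +
          (∏ i ∈ Finset.range (k + 2), ((i : ℝ) + 1 - s * v)) / ((k + 2)! : ℝ)) := by
      rw [intervalIntegral.integral_add, intervalIntegral.integral_add,
        intervalIntegral.integral_const_mul, intervalIntegral.integral_const_mul]
      · simp only [invToddLogSum]
        ring
      all_goals exact (by fun_prop : Continuous _).intervalIntegrable _ _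
    rw [e]
    refine intervalIntegral.integral_nonneg zero_le_one fun v hv => ?_
    have hsv : 0 ≤ s * v := mul_nonneg h0 hv.1
    have hsv1 : s * v ≤ 1 := mul_le_one₀ h1 hv.1 hv.2
    set a := s * v
    have hp := div_nonneg (prod_succ_sub_nonneg hsv1 k) (by positivity : (0 : ℝ) ≤ (k ! : ℝ))
    set p := (∏ i ∈ Finset.range k, ((i : ℝ) + 1 - a)) / (k ! : ℝ) with hpdef
    have hk : (0 : ℝ) ≤ k := Nat.cast_nonneg k
    have n0 : (k ! : ℝ) ≠ 0 := by positivity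
    have e1 : (∏ i ∈ Finset.range (k + 1), ((i : ℝ) + 1 - a)) / ((k + 1)! : ℝ) =
        p * (1 - a / (k + 1)) := by
      rw [Finset.prod_range_succ, Nat.factorial_succ, hpdef]
      push_cast
      field_simp
    have e2 : (∏ i ∈ Finset.range (k + 2), ((i : ℝ) + 1 - a)) / ((k + 2)! : ℝ) =
        p * ((1 - a / (k + 1)) * (1 - a / (k + 2))) := by
      rw [Finset.prod_range_succ, Finset.prod_range_succ, Nat.factorial_succ, Nat.factorial_succ,
        hpdef]
      push_cast
      field_simp
      ring
    rw [e1, e2]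
    have f1 : 0 ≤ 1 - a / (k + 1) := by
      rw [sub_nonneg, div_le_one (by positivity)]
      linarith
    have f2 : 1 - a / (k + 1) ≤ 1 - a / (k + 2) := by
      have : a / ((k : ℝ) + 2) ≤ a / (k + 1) := by gcongr; norm_num
      linarith
    have f3 := mul_le_mul_of_nonneg_left f2 f1
    have f4 : 0 ≤ x * x + 2 * x * (1 - a / (k + 1)) +
        (1 - a / (k + 1)) * (1 - a / (k + 2)) := by
      nlinarith [sq_nonneg (x + (1 - a / (k + 1)))]
    have := mul_nonneg hp f4
    linarith
  have h := discrim_le_zero key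
  rw [discrim] at h
  linarith

/-- Partial sums correspond to division by 1-X, so the reciprocal of the partial-sum series is (1-X)
times the Todd series. Its coefficients are the differences of the Todd coefficients, and Kaluza's
theorem makes them nonpositive. -/
theorem toddLogCoeff_succ_le {s : ℝ} (h0 : 0 ≤ s) (h1 : s ≤ 1) (k : ℕ) :
    toddLogCoeff s (k + 1) ≤ toddLogCoeff s k := by
  set w : ℕ → ℝ := fun k =>
    PowerSeries.coeff k ((1 - PowerSeries.X) * PowerSeries.mk (toddLogCoeff s)) with hw
  have e1 : PowerSeries.mk w = (1 - PowerSeries.X) * PowerSeries.mk (toddLogCoeff s) := by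
    ext k; simp [hw]
  have e2 : (1 - PowerSeries.X) * PowerSeries.mk (invToddLogSum s) =
      PowerSeries.mk (invToddLogCoeff s) := by
    ext k
    rw [sub_mul, one_mul, map_sub]
    rcases k with _ | k
    · simp [invToddLogCoeff_zero, invToddLogSum_zero]
    · rw [PowerSeries.coeff_succ_X_mul]
      simp [invToddLogSum_succ]
  have h : PowerSeries.mk w * PowerSeries.mk (invToddLogSum s) = 1 := by
    rw [e1, mul_right_comm, e2, mul_comm, mk_todd_mul_mk_invTodd s]
  have := nonpos_of_mk_mul_mk_eq_one_of_log_convex h (invToddLogSum_zero s)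
    (invToddLogSum_pos h1) (invToddLogSum_log_convex h0 h1) k
  rw [hw] at this
  simp only [sub_mul, one_mul, map_sub, PowerSeries.coeff_succ_X_mul, PowerSeries.coeff_mk] at this
  linarith

/-! ### Convergence of the expansions at x = 1 - e^{-t} -/

theorem ring_choose_mul_neg_pow (a x : ℝ) (k : ℕ) :
    Ring.choose a k * (-x) ^ k = (∏ i ∈ Finset.range k, ((i : ℝ) - a)) / (k ! : ℝ) * x ^ k := by
  have h : ∀ k : ℕ, (k ! : ℝ) * Ring.choose a k = ∏ i ∈ Finset.range k, (a - (i : ℝ)) := by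
    intro k
    have := Ring.descPochhammer_eq_factorial_smul_choose a k
    rw [nsmul_eq_mul] at this
    rw [← this]
    clear this
    induction k with
    | zero => simp
    | succ k ih =>
      rw [Finset.prod_range_succ, ← ih, descPochhammer_succ_right, Polynomial.smeval_mul,
        Polynomial.smeval_sub]
      simp [Polynomial.smeval_natCast]
  have h2 : ∏ i ∈ Finset.range k, (a - (i : ℝ)) =
      (-1) ^ k * ∏ i ∈ Finset.range k, ((i : ℝ) - a) := by
    rw [← Finset.card_range k, ← Finset.prod_const, Finset.card_range, ← Finset.prod_mul_distrib]
    exact Finset.prod_congr rfl fun i _ => by ring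
  have h3 : ((-1 : ℝ) ^ k) * (-1) ^ k = 1 := by rw [← mul_pow]; simp
  have h4 := h k
  have h5 : (k ! : ℝ) ≠ 0 := by positivity
  rw [h2] at h4
  rw [neg_pow x]
  field_simp
  linear_combination (-1 : ℝ) ^ k * x ^ k * h4 + (∏ i ∈ Finset.range k, ((i : ℝ) - a)) * x ^ k * h3

/-- The binomial series of `(1 - x) ^ a`. -/
theorem hasSum_one_sub_rpow (a : ℝ) {x : ℝ} (hx : |x| < 1) :
    HasSum (fun k => (∏ i ∈ Finset.range k, ((i : ℝ) - a)) / (k ! : ℝ) * x ^ k) ((1 - x) ^ a) := by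
  have h := (Real.one_add_rpow_hasFPowerSeriesOnBall_zero (a := a)).hasSum (y := -x)
    (by simpa [← ofReal_norm, ENNReal.ofReal_lt_one] using hx)
  rw [zero_add, ← sub_eq_add_neg] at h
  convert! h using 1
  ext k
  rw [← ring_choose_mul_neg_pow, binomialSeries_apply]
  simp

theorem abs_prod_sub_div_factorial_le_one {a : ℝ} (h0 : 0 ≤ a) (h1 : a ≤ 1) (k : ℕ) :
    |(∏ i ∈ Finset.range k, ((i : ℝ) - a)) / (k ! : ℝ)| ≤ 1 := by
  rw [abs_div, abs_of_pos (by positivity : (0 : ℝ) < (k ! : ℝ)), div_le_one (by positivity),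
    Finset.abs_prod, ← Finset.prod_range_add_one_eq_factorial]
  push_cast
  refine Finset.prod_le_prod (fun _ _ => abs_nonneg _) fun i _ => ?_
  have : (0 : ℝ) ≤ i := Nat.cast_nonneg i
  rw [abs_le]
  constructor <;> linarith

theorem hasSum_invToddLogCoeff {s t : ℝ} (h0 : 0 < s) (h1 : s ≤ 1) (ht : 0 < t) :
    HasSum (fun k => invToddLogCoeff s k * (1 - Real.exp (-t)) ^ k)
      ((1 - Real.exp (-(s * t))) / (s * t)) := by
  set x := 1 - Real.exp (-t) with hx
  have hx0 : 0 ≤ x := by rw [hx, sub_nonneg, Real.exp_le_one_iff]; linarith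
  have hx1 : x < 1 := by rw [hx]; linarith [Real.exp_pos (-t)]
  have hint : ∫ v in (0 : ℝ)..1, (1 - x) ^ (s * v) = (1 - Real.exp (-(s * t))) / (s * t) := by
    have e : ∀ v : ℝ, (1 - x) ^ (s * v) = Real.exp (-(s * t) * v) := by
      intro v
      rw [hx, sub_sub_cancel, ← Real.exp_mul]
      ring_nf
    have hc : -(s * t) ≠ 0 := by
      have := mul_pos h0 ht
      linarith
    simp only [e]
    rw [intervalIntegral.integral_comp_mul_left (fun y => Real.exp y) hc, integral_exp]
    simp
    field_simp
    ring
  rw [← hint]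
  have := intervalIntegral.hasSum_integral_of_dominated_convergence (μ := MeasureTheory.volume)
    (a := (0 : ℝ)) (b := 1)
    (F := fun k v => (∏ i ∈ Finset.range k, ((i : ℝ) - s * v)) / (k ! : ℝ) * x ^ k)
    (f := fun v => (1 - x) ^ (s * v)) (fun k _ => x ^ k)
    (fun k => (by fun_prop : Continuous _).aestronglyMeasurable)
    (fun k => Filter.Eventually.of_forall fun v hv => ?_)
    (Filter.Eventually.of_forall fun v _ => summable_geometric_of_lt_one hx0 hx1)
    (by simp)
    (Filter.Eventually.of_forall fun v _ => hasSum_one_sub_rpow _ (by rwa [abs_of_nonneg hx0]))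
  · convert! this using 1
    ext k
    rw [invToddLogCoeff_eq_integral, intervalIntegral.integral_mul_const]
  · rw [Set.uIoc_of_le zero_le_one] at hv
    rw [norm_mul, norm_pow, Real.norm_of_nonneg hx0, Real.norm_eq_abs]
    exact mul_le_of_le_one_left (by positivity) (abs_prod_sub_div_factorial_le_one
      (mul_nonneg h0.le hv.1.le) (mul_le_one₀ h1 hv.1.le hv.2) k)

theorem toddLogCoeff_zero (s : ℝ) : toddLogCoeff s 0 = 1 := by
  simp [toddLogCoeff, stirlingTransform]

theorem toddLogCoeff_le_one {s : ℝ} (h0 : 0 ≤ s) (h1 : s ≤ 1) (k : ℕ) : toddLogCoeff s k ≤ 1 := by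
  rw [← toddLogCoeff_zero s]
  exact antitone_nat_of_succ_le (toddLogCoeff_succ_le h0 h1) (Nat.zero_le k)

theorem abs_invToddLogCoeff_le_one {s : ℝ} (h0 : 0 ≤ s) (h1 : s ≤ 1) (k : ℕ) :
    |invToddLogCoeff s k| ≤ 1 := by
  rw [invToddLogCoeff_eq_integral, ← Real.norm_eq_abs]
  have := intervalIntegral.norm_integral_le_of_norm_le_const (a := (0 : ℝ)) (b := 1) (C := 1)
    (f := fun v => (∏ i ∈ Finset.range k, ((i : ℝ) - s * v)) / (k ! : ℝ)) fun v hv => by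
      rw [Set.uIoc_of_le zero_le_one] at hv
      exact abs_prod_sub_div_factorial_le_one (mul_nonneg h0 hv.1.le)
        (mul_le_one₀ h1 hv.1.le hv.2) k
  simpa using this

theorem summable_norm_mul_pow_of_abs_le_one {u : ℕ → ℝ} (hu : ∀ k, |u k| ≤ 1) {x : ℝ}
    (hx0 : 0 ≤ x) (hx1 : x < 1) : Summable fun k => ‖u k * x ^ k‖ := by
  refine Summable.of_nonneg_of_le (fun k => norm_nonneg _) (fun k => ?_)
    (summable_geometric_of_lt_one hx0 hx1)
  rw [norm_mul, norm_pow, Real.norm_of_nonneg hx0, Real.norm_eq_abs]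
  exact mul_le_of_le_one_left (by positivity) (hu k)

/-- Both coefficient sequences are bounded by 1, so the two series converge absolutely and their
Cauchy product is the formal product, namely 1. -/
theorem hasSum_toddLogCoeff {s t : ℝ} (h0 : 0 < s) (h1 : s ≤ 1) (ht : 0 < t) :
    HasSum (fun k => toddLogCoeff s k * (1 - Real.exp (-t)) ^ k)
      (s * t / (1 - Real.exp (-(s * t)))) := by
  have hq := hasSum_invToddLogCoeff h0 h1 ht
  set x := 1 - Real.exp (-t) with hx
  have hx0 : 0 ≤ x := by rw [hx, sub_nonneg, Real.exp_le_one_iff]; linarith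
  have hx1 : x < 1 := by rw [hx]; linarith [Real.exp_pos (-t)]
  have su := summable_norm_mul_pow_of_abs_le_one (u := toddLogCoeff s) (fun k => by
    rw [abs_of_nonneg (toddLogCoeff_nonneg h0.le h1 k)]
    exact toddLogCoeff_le_one h0.le h1 k) hx0 hx1
  have sq := summable_norm_mul_pow_of_abs_le_one (abs_invToddLogCoeff_le_one h0.le h1) hx0 hx1
  have hprod := tsum_mul_tsum_eq_tsum_sum_range_of_summable_norm su sq
  have e : ∀ k, ∑ j ∈ Finset.range (k + 1),
      toddLogCoeff s j * x ^ j * (invToddLogCoeff s (k - j) * x ^ (k - j)) =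
      if k = 0 then 1 else 0 := by
    intro k
    have e1 : ∀ j ∈ Finset.range (k + 1),
        toddLogCoeff s j * x ^ j * (invToddLogCoeff s (k - j) * x ^ (k - j)) =
        toddLogCoeff s j * invToddLogCoeff s (k - j) * x ^ k := by
      intro j hj
      have hj := Finset.mem_range.1 hj
      have : x ^ k = x ^ j * x ^ (k - j) := by rw [← pow_add]; congr 1; omega
      rw [this]
      ring
    rw [Finset.sum_congr rfl e1, ← Finset.sum_mul]
    rcases k with _ | k
    · simp [toddLogCoeff_zero, invToddLogCoeff_zero]
    · rw [sum_antidiagonal_of_mk_mul_mk_eq_one (mk_todd_mul_mk_invTodd s)]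
      simp
  simp only [e, tsum_ite_eq] at hprod
  rw [hq.tsum_eq] at hprod
  have hst : 0 < s * t := mul_pos h0 ht
  have hne : 1 - Real.exp (-(s * t)) ≠ 0 := by
    have : Real.exp (-(s * t)) < 1 := by rw [Real.exp_lt_one_iff]; linarith
    linarith
  have := su.of_norm.hasSum
  convert! this using 1
  field_simp at hprod ⊢
  linarith

/-! ### Inverse factorials as Laplace transforms -/

/-- The Laplace transform `k! / (a (a+1) ⋯ (a+k))` of `(1 - e^{-t}) ^ k` at `a`. -/
noncomputable def invFactorialTerm (a : ℝ) (k : ℕ) : ℝ :=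
  (k ! : ℝ) / ∏ i ∈ Finset.range (k + 1), (a + (i : ℝ))

theorem prod_range_add_pos {a : ℝ} (ha : 0 < a) (k : ℕ) :
    0 < ∏ i ∈ Finset.range k, (a + (i : ℝ)) :=
  Finset.prod_pos fun i _ => by positivity

theorem invFactorialTerm_pos {a : ℝ} (ha : 0 < a) (k : ℕ) : 0 < invFactorialTerm a k :=
  div_pos (by positivity) (prod_range_add_pos ha _)

theorem invFactorialTerm_zero (a : ℝ) : invFactorialTerm a 0 = 1 / a := by
  simp [invFactorialTerm]

theorem invFactorialTerm_add_one {a : ℝ} (ha : 0 < a) (k : ℕ) :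
    (k + 1) * invFactorialTerm (a + 1) k = a * invFactorialTerm a (k + 1) := by
  have h := prod_range_add_pos (by linarith : 0 < a + 1) (k + 1)
  have e : ∏ i ∈ Finset.range (k + 1), (a + ((i + 1 : ℕ) : ℝ)) =
      ∏ i ∈ Finset.range (k + 1), (a + 1 + (i : ℝ)) :=
    Finset.prod_congr rfl fun i _ => by push_cast; ring
  rw [invFactorialTerm, invFactorialTerm, Finset.prod_range_succ' _ (k + 1), e,
    Nat.factorial_succ]
  push_cast
  field_simp
  simp

theorem invFactorialTerm_succ {a : ℝ} (ha : 0 < a) (k : ℕ) :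
    (k + 1) * invFactorialTerm a k = (a + k + 1) * invFactorialTerm a (k + 1) := by
  have h := prod_range_add_pos ha (k + 1)
  have h' : a + ((k : ℝ) + 1) ≠ 0 := by positivity
  rw [invFactorialTerm, invFactorialTerm, Finset.prod_range_succ _ (k + 1), Nat.factorial_succ]
  push_cast
  field_simp
  ring

theorem invFactorialTerm_sub {a : ℝ} (ha : 0 < a) (k : ℕ) :
    invFactorialTerm a k - invFactorialTerm (a + 1) k = invFactorialTerm a (k + 1) := by
  have h3 : ((k : ℝ) + 1) ≠ 0 := by positivity
  apply mul_left_cancel₀ h3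
  linear_combination invFactorialTerm_succ ha k - invFactorialTerm_add_one ha k

theorem invFactorialTerm_one (k : ℕ) : invFactorialTerm 1 k = 1 / ((k : ℝ) + 1) := by
  have e : ∏ i ∈ Finset.range (k + 1), ((1 : ℝ) + (i : ℝ)) = ((k + 1)! : ℝ) := by
    rw [← Finset.prod_range_add_one_eq_factorial]
    push_cast
    exact Finset.prod_congr rfl fun i _ => add_comm _ _
  rw [invFactorialTerm, e, Nat.factorial_succ]
  push_cast
  field_simp

theorem invFactorialTerm_le {a : ℝ} (ha : 1 ≤ a) (k : ℕ) :
    invFactorialTerm a k ≤ 1 / ((k : ℝ) + 1) := by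
  rw [← invFactorialTerm_one]
  refine div_le_div_of_nonneg_left (by positivity) (prod_range_add_pos one_pos _) ?_
  exact Finset.prod_le_prod (fun i _ => by positivity) fun i _ => by linarith

/-- Multiplying by 1 - e^{-t} takes the difference between the transforms at a and a+1, which is
`invFactorialTerm_sub`. -/
theorem integrableOn_and_integral_exp_mul_one_sub_exp_pow (k : ℕ) {a : ℝ} (ha : 0 < a) :
    IntegrableOn (fun t => Real.exp (-a * t) * (1 - Real.exp (-t)) ^ k) (Set.Ioi 0) ∧
      ∫ t in Set.Ioi (0 : ℝ), Real.exp (-a * t) * (1 - Real.exp (-t)) ^ k =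
        invFactorialTerm a k := by
  induction k generalizing a with
  | zero =>
    simp only [pow_zero, mul_one]
    refine ⟨integrableOn_exp_mul_Ioi (by linarith) 0, ?_⟩
    rw [integral_exp_mul_Ioi (by linarith), invFactorialTerm_zero]
    simp
  | succ k ih =>
    have e : (fun t => Real.exp (-a * t) * (1 - Real.exp (-t)) ^ (k + 1)) =
        fun t => Real.exp (-a * t) * (1 - Real.exp (-t)) ^ k -
          Real.exp (-(a + 1) * t) * (1 - Real.exp (-t)) ^ k := by
      ext t
      have : Real.exp (-(a + 1) * t) = Real.exp (-a * t) * Real.exp (-t) := by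
        rw [← Real.exp_add]; ring_nf
      rw [this, pow_succ]
      ring
    obtain ⟨i1, v1⟩ := ih ha
    obtain ⟨i2, v2⟩ := ih (by linarith : 0 < a + 1)
    rw [e]
    refine ⟨i1.sub i2, ?_⟩
    rw [integral_sub i1 i2, v1, v2, invFactorialTerm_sub ha]

theorem integrableOn_mul_exp_neg_mul {a : ℝ} (ha : 0 < a) :
    IntegrableOn (fun t => t * Real.exp (-a * t)) (Set.Ioi 0) := by
  have := integrableOn_rpow_mul_exp_neg_mul_rpow (p := 1) (s := 1) (b := a) (by norm_num)
    (by norm_num) ha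
  simpa using this

theorem integral_mul_exp_neg_mul {a : ℝ} (ha : 0 < a) :
    ∫ t in Set.Ioi (0 : ℝ), t * Real.exp (-a * t) = 1 / a ^ 2 := by
  have := Real.integral_rpow_mul_exp_neg_mul_Ioi (a := 2) (r := a) (by norm_num) ha
  have e : (2 : ℝ) - 1 = 1 := by norm_num
  rw [Real.Gamma_two, e] at this
  simpa using this

theorem div_one_sub_exp_neg_le {v : ℝ} (hv : 0 < v) : v / (1 - Real.exp (-v)) ≤ 1 + v := by
  have h1 : 0 < 1 - Real.exp (-v) := by
    rw [sub_pos, Real.exp_lt_one_iff]; linarith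
  rw [div_le_iff₀ h1]
  have h2 : (1 + v) * Real.exp (-v) ≤ 1 := by
    rw [Real.exp_neg, ← div_eq_mul_inv, div_le_one (Real.exp_pos v)]
    linarith [Real.add_one_le_exp v]
  nlinarith

/-- The weight 1/(k+1) is the integral of e^{-t}(1-e^{-t})^k. Positivity bounds partial sums by the
full series st/(1-e^{-st}) ≤ 1 + st, and ∫ e^{-t}(1+st) dt = 1 + s. -/
theorem sum_toddLogCoeff_div_le {s : ℝ} (h0 : 0 < s) (h1 : s ≤ 1) (K : ℕ) :
    ∑ k ∈ Finset.range K, toddLogCoeff s k / ((k : ℝ) + 1) ≤ 1 + s := by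
  have e : ∑ k ∈ Finset.range K, toddLogCoeff s k / ((k : ℝ) + 1) =
      ∫ t in Set.Ioi (0 : ℝ), ∑ k ∈ Finset.range K,
        toddLogCoeff s k * (Real.exp (-1 * t) * (1 - Real.exp (-t)) ^ k) := by
    rw [integral_finsetSum]
    · refine Finset.sum_congr rfl fun k _ => ?_
      rw [integral_const_mul, (integrableOn_and_integral_exp_mul_one_sub_exp_pow k one_pos).2,
        invFactorialTerm_one]
      ring
    · exact fun k _ =>
        (integrableOn_and_integral_exp_mul_one_sub_exp_pow k one_pos).1.const_mul _
  have i1 : IntegrableOn (fun t => Real.exp (-1 * t)) (Set.Ioi 0) :=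
    integrableOn_exp_mul_Ioi (by norm_num) 0
  have i2 := integrableOn_mul_exp_neg_mul one_pos
  have e2 : ∫ t in Set.Ioi (0 : ℝ), (Real.exp (-1 * t) + s * (t * Real.exp (-1 * t))) = 1 + s := by
    rw [integral_add i1 (i2.const_mul s), integral_const_mul, integral_mul_exp_neg_mul one_pos,
      integral_exp_mul_Ioi (by norm_num)]
    simp
  rw [e, ← e2]
  refine setIntegral_mono_on ?_ (i1.add (i2.const_mul s)) measurableSet_Ioi fun t ht => ?_
  · exact integrable_finsetSum _ fun k _ =>
      (integrableOn_and_integral_exp_mul_one_sub_exp_pow k one_pos).1.const_mul _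
  · have ht : 0 < t := ht
    have hs := hasSum_toddLogCoeff h0 h1 ht
    have hx0 : 0 ≤ 1 - Real.exp (-t) := by
      rw [sub_nonneg, Real.exp_le_one_iff]; linarith
    have hle := sum_le_hasSum (Finset.range K) (fun k _ =>
      mul_nonneg (toddLogCoeff_nonneg h0.le h1 k) (pow_nonneg hx0 k)) hs
    have h3 := hle.trans (div_one_sub_exp_neg_le (mul_pos h0 ht))
    have h4 := mul_le_mul_of_nonneg_left h3 (Real.exp_pos (-1 * t)).le
    rw [Finset.mul_sum] at h4
    calc _ = ∑ k ∈ Finset.range K,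
          Real.exp (-1 * t) * (toddLogCoeff s k * (1 - Real.exp (-t)) ^ k) :=
        Finset.sum_congr rfl fun k _ => by ring
      _ ≤ _ := h4
      _ = _ := by ring

/-! ### The inverse factorial series for fixed s -/

/-- The coefficients in `x` of `v / (e^v - 1)` at `v = -s log (1 - x)`. -/
noncomputable def bernoulliLogCoeff (s : ℝ) (k : ℕ) : ℝ :=
  stirlingTransform (fun l => (bernoulli l : ℝ) * s ^ l) k

/-- v/(e^v-1) = v/(1-e^{-v}) - v, and v = s Σ x^k/k. The convention 0⁻¹ = 0 covers k = 0. -/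
theorem bernoulliLogCoeff_eq (s : ℝ) (k : ℕ) :
    bernoulliLogCoeff s k = toddLogCoeff s k - s * (k : ℝ)⁻¹ := by
  rcases k with _ | k
  · simp [bernoulliLogCoeff, toddLogCoeff, stirlingTransform]
  have h : ∀ l, (Nat.stirlingFirst (k + 1) l : ℝ) * ((bernoulli l : ℝ) * s ^ l) =
      (Nat.stirlingFirst (k + 1) l : ℝ) * ((bernoulli' l : ℝ) * s ^ l) -
        if l = 1 then (k ! : ℝ) * s else 0 := by
    intro l
    split_ifs with hl
    · subst hl
      rw [Nat.stirlingFirst_one_right, bernoulli_one, bernoulli'_one]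
      push_cast
      ring
    · rw [bernoulli_eq_bernoulli'_of_ne_one hl, sub_zero]
  have n0 : (k ! : ℝ) ≠ 0 := by positivity
  rw [bernoulliLogCoeff, toddLogCoeff, stirlingTransform, stirlingTransform]
  simp only [h]
  rw [Finset.sum_sub_distrib, Finset.sum_ite_eq', if_pos (by simp), sub_div, Nat.factorial_succ]
  push_cast
  congr 1
  field_simp

theorem abs_bernoulliLogCoeff_le {s : ℝ} (h0 : 0 ≤ s) (h1 : s ≤ 1) (k : ℕ) :
    |bernoulliLogCoeff s k| ≤ toddLogCoeff s k + s * (k : ℝ)⁻¹ := by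
  have h2 := toddLogCoeff_nonneg h0 h1 k
  have h3 : 0 ≤ s * (k : ℝ)⁻¹ := by positivity
  rw [bernoulliLogCoeff_eq, abs_le]
  constructor <;> linarith

theorem summable_inv_mul_one_div_succ : Summable fun k : ℕ => (k : ℝ)⁻¹ * (1 / ((k : ℝ) + 1)) := by
  refine Summable.of_nonneg_of_le (fun k => by positivity) (fun k => ?_)
    (Real.summable_nat_pow_inv.2 one_lt_two)
  rcases k with _ | k
  · simp
  · rw [← one_div, ← one_div, one_div_mul_one_div, pow_two]
    gcongr
    linarith

theorem summable_toddLogCoeff_div {s : ℝ} (h0 : 0 < s) (h1 : s ≤ 1) :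
    Summable fun k => toddLogCoeff s k / ((k : ℝ) + 1) :=
  summable_of_sum_range_le (fun k => div_nonneg (toddLogCoeff_nonneg h0.le h1 k) (by positivity))
    (sum_toddLogCoeff_div_le h0 h1)

theorem summable_abs_bernoulliLogCoeff_mul {s a : ℝ} (h0 : 0 < s) (h1 : s ≤ 1) (ha : 1 ≤ a) :
    Summable fun k => |bernoulliLogCoeff s k| * invFactorialTerm a k := by
  refine Summable.of_nonneg_of_le (fun k => mul_nonneg (abs_nonneg _)
    (invFactorialTerm_pos (by linarith) k).le) (fun k => ?_)
    ((summable_toddLogCoeff_div h0 h1).add (summable_inv_mul_one_div_succ.mul_left s))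
  calc |bernoulliLogCoeff s k| * invFactorialTerm a k
      ≤ (toddLogCoeff s k + s * (k : ℝ)⁻¹) * (1 / ((k : ℝ) + 1)) :=
        mul_le_mul (abs_bernoulliLogCoeff_le h0.le h1 k) (invFactorialTerm_le ha k)
          (invFactorialTerm_pos (by linarith) k).le ((abs_nonneg _).trans
            (abs_bernoulliLogCoeff_le h0.le h1 k))
    _ = _ := by ring

theorem hasSum_bernoulliLogCoeff_mul_pow {s t : ℝ} (h0 : 0 < s) (h1 : s ≤ 1) (ht : 0 < t) :
    HasSum (fun k => bernoulliLogCoeff s k * (1 - Real.exp (-t)) ^ k)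
      (s * t / (1 - Real.exp (-(s * t))) - s * t) := by
  have hx0 : 0 ≤ 1 - Real.exp (-t) := by rw [sub_nonneg, Real.exp_le_one_iff]; linarith
  have hx1 : 1 - Real.exp (-t) < 1 := by linarith [Real.exp_pos (-t)]
  have h2 := Real.hasSum_pow_div_log_of_abs_lt_one (x := 1 - Real.exp (-t))
    (by rwa [abs_of_nonneg hx0])
  rw [sub_sub_cancel, Real.log_exp, neg_neg] at h2
  have h3 : HasSum (fun k : ℕ => (1 - Real.exp (-t)) ^ k * (k : ℝ)⁻¹) t := by
    rw [← hasSum_nat_add_iff' 1]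
    simpa [div_eq_mul_inv] using h2
  convert! (hasSum_toddLogCoeff h0 h1 ht).sub (h3.mul_left s) using 1
  ext k
  rw [bernoulliLogCoeff_eq]
  ring

theorem hasSum_exp_neg_succ {v : ℝ} (hv : 0 < v) :
    HasSum (fun m : ℕ => v * Real.exp (-(((m : ℝ) + 1) * v))) (v / (1 - Real.exp (-v)) - v) := by
  have h1 : Real.exp (-v) < 1 := by rw [Real.exp_lt_one_iff]; linarith
  have h2 := (hasSum_geometric_of_lt_one (Real.exp_pos (-v)).le h1).mul_left (v * Real.exp (-v))
  have h3 : 1 - Real.exp (-v) ≠ 0 := by linarith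
  convert! h2 using 1
  · ext m
    rw [← Real.exp_nat_mul, mul_assoc, ← Real.exp_add]
    ring_nf
  · field_simp
    ring

/-- A Hurwitz-type series `∑ s / (a + (m + 1) s)²` converges. -/
theorem summable_div_sq {s a : ℝ} (h0 : 0 < s) (ha : 0 < a) :
    Summable fun m : ℕ => s / (a + ((m : ℝ) + 1) * s) ^ 2 := by
  have h : Summable fun m : ℕ => (1 / s) * (((m + 1 : ℕ) : ℝ) ^ 2)⁻¹ :=
    ((summable_nat_add_iff 1).2 (Real.summable_nat_pow_inv.2 one_lt_two)).mul_left _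
  refine Summable.of_nonneg_of_le (fun m => by positivity) (fun m => ?_) h
  have : (1 / s) * (((m + 1 : ℕ) : ℝ) ^ 2)⁻¹ = s / (((m : ℝ) + 1) * s) ^ 2 := by
    push_cast
    field_simp
  rw [this]
  gcongr
  linarith

/-- The integral of e^{-at} st/(e^{st}-1) over t > 0 is evaluated termwise in two ways: in powers of
1-e^{-t} (`A`) and in powers of e^{-st} (`B`). -/
theorem hasSum_bernoulliLogCoeff_mul_invFactorialTerm {s a : ℝ} (h0 : 0 < s) (h1 : s ≤ 1)
    (ha : 1 ≤ a) :
    HasSum (fun k => bernoulliLogCoeff s k * invFactorialTerm a k)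
      (∑' m : ℕ, s / (a + ((m : ℝ) + 1) * s) ^ 2) := by
  have ha0 : 0 < a := by linarith
  have hx0 : ∀ t ∈ Set.Ioi (0 : ℝ), 0 ≤ 1 - Real.exp (-t) := fun t ht => by
    have ht : 0 < t := ht
    rw [sub_nonneg, Real.exp_le_one_iff]; linarith
  have A := hasSum_integral_of_summable_integral_norm (μ := volume.restrict (Set.Ioi (0 : ℝ)))
    (F := fun k t => bernoulliLogCoeff s k * (Real.exp (-a * t) * (1 - Real.exp (-t)) ^ k))
    (fun k => (integrableOn_and_integral_exp_mul_one_sub_exp_pow k ha0).1.const_mul _) (by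
      convert! summable_abs_bernoulliLogCoeff_mul h0 h1 ha using 1
      ext k
      rw [← (integrableOn_and_integral_exp_mul_one_sub_exp_pow k ha0).2, ← integral_const_mul]
      refine setIntegral_congr_fun measurableSet_Ioi fun t ht => ?_
      rw [norm_mul, Real.norm_eq_abs, Real.norm_of_nonneg]
      exact mul_nonneg (Real.exp_pos _).le (pow_nonneg (hx0 t ht) k))
  have e1 : ∀ (m : ℕ) (t : ℝ), Real.exp (-a * t) * (s * t * Real.exp (-(((m : ℝ) + 1) * (s * t)))) =
      s * (t * Real.exp (-(a + ((m : ℝ) + 1) * s) * t)) := by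
    intro m t
    have : Real.exp (-(a + ((m : ℝ) + 1) * s) * t) =
        Real.exp (-a * t) * Real.exp (-(((m : ℝ) + 1) * (s * t))) := by
      rw [← Real.exp_add]; ring_nf
    rw [this]
    ring
  have hpos : ∀ m : ℕ, 0 < a + ((m : ℝ) + 1) * s := fun m => by positivity
  have v : ∀ m : ℕ, ∫ t in Set.Ioi (0 : ℝ),
      Real.exp (-a * t) * (s * t * Real.exp (-(((m : ℝ) + 1) * (s * t)))) =
        s / (a + ((m : ℝ) + 1) * s) ^ 2 := by
    intro m
    simp only [e1]
    rw [integral_const_mul, integral_mul_exp_neg_mul (hpos m)]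
    ring
  have B := hasSum_integral_of_summable_integral_norm (μ := volume.restrict (Set.Ioi (0 : ℝ)))
    (F := fun (m : ℕ) t => Real.exp (-a * t) * (s * t * Real.exp (-(((m : ℝ) + 1) * (s * t)))))
    (fun m => by
      simp only [e1]
      exact (integrableOn_mul_exp_neg_mul (hpos m)).const_mul s) (by
      convert! summable_div_sq h0 ha0 using 1
      ext m
      rw [← v]
      refine setIntegral_congr_fun measurableSet_Ioi fun t ht => ?_
      have ht : 0 < t := ht
      exact Real.norm_of_nonneg (by positivity))
  simp only [v] at B
  rw [B.tsum_eq]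
  convert! A using 1
  · ext k
    rw [integral_const_mul, (integrableOn_and_integral_exp_mul_one_sub_exp_pow k ha0).2]
  · refine setIntegral_congr_fun measurableSet_Ioi fun t ht => ?_
    have ht : 0 < t := ht
    rw [((hasSum_exp_neg_succ (mul_pos h0 ht)).mul_left _).tsum_eq]
    have := (hasSum_bernoulliLogCoeff_mul_pow h0 h1 ht).mul_left (Real.exp (-a * t))
    rw [← this.tsum_eq]
    exact tsum_congr fun k => by ring

/-! ### Trigonometric integrals for the average over s = sin²θ -/

theorem hasDerivAt_sin_mul_cos (θ : ℝ) :
    HasDerivAt (fun θ => Real.sin θ * Real.cos θ) (1 - 2 * Real.sin θ ^ 2) θ := by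
  have := (Real.hasDerivAt_sin θ).mul (Real.hasDerivAt_cos θ)
  convert! this using 1
  linear_combination -Real.sin_sq_add_cos_sq θ

theorem hasDerivAt_const_add_mul_sin_sq (a b θ : ℝ) :
    HasDerivAt (fun θ => a + b * Real.sin θ ^ 2) (2 * b * (Real.sin θ * Real.cos θ)) θ := by
  have := (((Real.hasDerivAt_sin θ).pow 2).const_mul b).const_add a
  convert! this using 1
  simp
  ring

/-- A continuous branch of `arctan ((1 + κ) tan θ)`. -/
theorem hasDerivAt_add_arctan {κ : ℝ} (hκ : 0 ≤ κ) (θ : ℝ) :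
    HasDerivAt
      (fun θ => θ + Real.arctan (κ * (Real.sin θ * Real.cos θ) / (1 + κ * Real.sin θ ^ 2)))
      ((1 + κ) / (1 + ((1 + κ) ^ 2 - 1) * Real.sin θ ^ 2)) θ := by
  have hE : 1 + κ * Real.sin θ ^ 2 ≠ 0 := by positivity
  have h := (hasDerivAt_id θ).add ((((hasDerivAt_sin_mul_cos θ).const_mul κ).div
    (hasDerivAt_const_add_mul_sin_sq 1 κ θ) hE).arctan)
  convert! h using 1
  have hc : Real.cos θ ^ 2 = 1 - Real.sin θ ^ 2 := by
    linear_combination Real.sin_sq_add_cos_sq θ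
  simp only [Pi.div_apply]
  have e : 1 + (κ * (Real.sin θ * Real.cos θ) / (1 + κ * Real.sin θ ^ 2)) ^ 2 =
      (1 + ((1 + κ) ^ 2 - 1) * Real.sin θ ^ 2) / (1 + κ * Real.sin θ ^ 2) ^ 2 := by
    rw [div_pow, mul_pow, mul_pow, hc]
    field_simp
    ring
  have hD : 1 + ((1 + κ) ^ 2 - 1) * Real.sin θ ^ 2 ≠ 0 := by
    have : 0 ≤ ((1 + κ) ^ 2 - 1) * Real.sin θ ^ 2 :=
      mul_nonneg (by nlinarith) (sq_nonneg _)
    linarith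
  rw [e]
  have e2 : κ * (1 - 2 * Real.sin θ ^ 2) * (1 + κ * Real.sin θ ^ 2) -
      κ * (Real.sin θ * Real.cos θ) * (2 * κ * (Real.sin θ * Real.cos θ)) =
      κ * (1 - 2 * Real.sin θ ^ 2 - κ * Real.sin θ ^ 2) := by
    linear_combination -2 * κ ^ 2 * Real.sin θ ^ 2 * hc
  rw [e2]
  field_simp
  ring

theorem integral_sin_sq_div_sq {a b : ℝ} (ha : 0 < a) (hb : 0 < b) :
    ∫ θ in (0 : ℝ)..Real.pi, Real.sin θ ^ 2 / (a + b * Real.sin θ ^ 2) ^ 2 =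
      Real.pi / (2 * √a * ((a + b) * √(a + b))) := by
  have hN : 0 < a + b := by linarith
  set p := √a with hp
  set q := √(a + b) with hq
  have p0 : 0 < p := Real.sqrt_pos.2 ha
  have q0 : 0 < q := Real.sqrt_pos.2 hN
  have pa : p ^ 2 = a := Real.sq_sqrt ha.le
  have qa : q ^ 2 = a + b := Real.sq_sqrt hN.le
  have hpq : p ≤ q := Real.sqrt_le_sqrt (by linarith)
  -- The natural primitive involves arctan((q/p) tan θ), which jumps at π/2. With 1 + κ = q/p, the
  -- continuous branch of `hasDerivAt_add_arctan` works on all of [0, π] and increases by π.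
  set κ := q / p - 1 with hκ
  have κ0 : 0 ≤ κ := by rw [hκ, sub_nonneg, one_le_div p0]; exact hpq
  have hder : ∀ θ : ℝ, HasDerivAt (fun θ =>
      -(1 / (2 * (a + b))) * (Real.sin θ * Real.cos θ / (a + b * Real.sin θ ^ 2)) +
      (1 / (2 * (a + b) * (p * q))) *
        (θ + Real.arctan (κ * (Real.sin θ * Real.cos θ) / (1 + κ * Real.sin θ ^ 2))))
      (Real.sin θ ^ 2 / (a + b * Real.sin θ ^ 2) ^ 2) θ := by
    intro θ
    have hD : a + b * Real.sin θ ^ 2 ≠ 0 := by positivity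
    have h := (((hasDerivAt_sin_mul_cos θ).div (hasDerivAt_const_add_mul_sin_sq a b θ)
      hD).const_mul (-(1 / (2 * (a + b))))).add
      ((hasDerivAt_add_arctan κ0 θ).const_mul (1 / (2 * (a + b) * (p * q))))
    convert! h using 1
    have e1 : (1 + κ) / (1 + ((1 + κ) ^ 2 - 1) * Real.sin θ ^ 2) =
        p * q / (a + b * Real.sin θ ^ 2) := by
      have : 1 + κ = q / p := by rw [hκ]; ring
      have e : 1 + ((1 + κ) ^ 2 - 1) * Real.sin θ ^ 2 = (a + b * Real.sin θ ^ 2) / p ^ 2 := by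
        rw [this, div_pow, qa, pa]
        field_simp
        ring
      rw [e, this]
      field_simp
    have hc : Real.cos θ ^ 2 = 1 - Real.sin θ ^ 2 := by
      linear_combination Real.sin_sq_add_cos_sq θ
    have e2 : (1 - 2 * Real.sin θ ^ 2) * (a + b * Real.sin θ ^ 2) -
        Real.sin θ * Real.cos θ * (2 * b * (Real.sin θ * Real.cos θ)) =
        a + b * Real.sin θ ^ 2 - 2 * (a + b) * Real.sin θ ^ 2 := by
      linear_combination -2 * b * Real.sin θ ^ 2 * hc
    rw [e1, e2]
    field_simp
    ring
  rw [intervalIntegral.integral_eq_sub_of_hasDerivAt (fun θ _ => hder θ)]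
  · simp
    field_simp
  · refine Continuous.intervalIntegrable ?_ _ _
    refine Continuous.div (by fun_prop) (by fun_prop) fun θ => ?_
    positivity

theorem integral_sin_sq_pow (l : ℕ) :
    ∫ θ in (0 : ℝ)..Real.pi, (Real.sin θ ^ 2) ^ l =
      Real.pi * (((2 * l - 1)‼ : ℝ) / (2 ^ l * (l ! : ℝ))) := by
  simp only [← pow_mul]
  rw [integral_sin_pow_even]
  congr 1
  induction l with
  | zero => simp
  | succ l ih =>
    have h : (2 * (l + 1) - 1)‼ = (2 * l + 1) * (2 * l - 1)‼ := by
      rcases l with _ | l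
      · simp
      · exact Nat.doubleFactorial_add_two (2 * l + 1)
    have n0 : (l ! : ℝ) ≠ 0 := by positivity
    rw [Finset.prod_range_succ, ih, h, Nat.factorial_succ]
    push_cast
    field_simp
    ring

theorem continuous_toddLogCoeff_sin_sq (k : ℕ) :
    Continuous fun θ : ℝ => toddLogCoeff (Real.sin θ ^ 2) k := by
  unfold toddLogCoeff stirlingTransform
  fun_prop

theorem continuous_bernoulliLogCoeff_sin_sq (k : ℕ) :
    Continuous fun θ : ℝ => bernoulliLogCoeff (Real.sin θ ^ 2) k := by
  unfold bernoulliLogCoeff stirlingTransform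
  fun_prop

theorem integral_stirlingTransform_sin_sq (h : ℕ → ℝ) (k : ℕ) :
    ∫ θ in (0 : ℝ)..Real.pi, stirlingTransform (fun l => h l * (Real.sin θ ^ 2) ^ l) k =
      Real.pi * stirlingTransform
        (fun l => h l * (((2 * l - 1)‼ : ℝ) / (2 ^ l * (l ! : ℝ)))) k := by
  unfold stirlingTransform
  rw [intervalIntegral.integral_div, intervalIntegral.integral_finsetSum, ← mul_div_assoc,
    Finset.mul_sum]
  · congr 1
    refine Finset.sum_congr rfl fun l _ => ?_
    rw [intervalIntegral.integral_const_mul, intervalIntegral.integral_const_mul,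
      integral_sin_sq_pow]
    ring
  · exact fun l _ => (by fun_prop : Continuous _).intervalIntegrable _ _

/-! ### Averaged coefficients and the averaged series -/

/-- The average of `toddLogCoeff (sin² θ)` over `[0, π]`. -/
noncomputable def avgToddLogCoeff (k : ℕ) : ℝ :=
  stirlingTransform (fun l => (bernoulli' l : ℝ) * (((2 * l - 1)‼ : ℝ) / (2 ^ l * (l ! : ℝ)))) k

/-- The average of `bernoulliLogCoeff (sin² θ)` over `[0, π]`. -/
noncomputable def avgBernoulliLogCoeff (k : ℕ) : ℝ :=
  stirlingTransform (fun l => (bernoulli l : ℝ) * (((2 * l - 1)‼ : ℝ) / (2 ^ l * (l ! : ℝ)))) k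

theorem integral_toddLogCoeff_sin_sq (k : ℕ) :
    ∫ θ in (0 : ℝ)..Real.pi, toddLogCoeff (Real.sin θ ^ 2) k = Real.pi * avgToddLogCoeff k :=
  integral_stirlingTransform_sin_sq _ k

theorem integral_bernoulliLogCoeff_sin_sq (k : ℕ) :
    ∫ θ in (0 : ℝ)..Real.pi, bernoulliLogCoeff (Real.sin θ ^ 2) k =
      Real.pi * avgBernoulliLogCoeff k :=
  integral_stirlingTransform_sin_sq _ k

theorem integral_sin_sq_zero_pi : ∫ θ in (0 : ℝ)..Real.pi, Real.sin θ ^ 2 = Real.pi / 2 := by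
  have := integral_sin_sq_pow 1
  simp only [pow_one] at this
  rw [this]
  simp
  ring

theorem avgBernoulliLogCoeff_eq (k : ℕ) :
    avgBernoulliLogCoeff k = avgToddLogCoeff k - 1 / 2 * (k : ℝ)⁻¹ := by
  apply mul_left_cancel₀ Real.pi_ne_zero
  rw [← integral_bernoulliLogCoeff_sin_sq, mul_sub, ← integral_toddLogCoeff_sin_sq]
  simp only [bernoulliLogCoeff_eq]
  rw [intervalIntegral.integral_sub ((continuous_toddLogCoeff_sin_sq k).intervalIntegrable _ _)
    ((by fun_prop : Continuous _).intervalIntegrable _ _), intervalIntegral.integral_mul_const,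
    integral_sin_sq_zero_pi]
  ring

theorem avgToddLogCoeff_nonneg (k : ℕ) : 0 ≤ avgToddLogCoeff k := by
  have h := intervalIntegral.integral_nonneg (μ := volume) Real.pi_pos.le fun θ _ =>
    toddLogCoeff_nonneg (sq_nonneg (Real.sin θ)) (Real.sin_sq_le_one θ) k
  rw [integral_toddLogCoeff_sin_sq] at h
  exact nonneg_of_mul_nonneg_right h Real.pi_pos

theorem avgToddLogCoeff_succ_le (k : ℕ) : avgToddLogCoeff (k + 1) ≤ avgToddLogCoeff k := by
  have h := intervalIntegral.integral_mono (μ := volume) Real.pi_pos.le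
    ((continuous_toddLogCoeff_sin_sq (k + 1)).intervalIntegrable _ _)
    ((continuous_toddLogCoeff_sin_sq k).intervalIntegrable _ _) fun θ =>
    toddLogCoeff_succ_le (sq_nonneg (Real.sin θ)) (Real.sin_sq_le_one θ) k
  rw [integral_toddLogCoeff_sin_sq, integral_toddLogCoeff_sin_sq] at h
  exact le_of_mul_le_mul_left h Real.pi_pos

theorem sum_avgToddLogCoeff_div_le (K : ℕ) :
    ∑ k ∈ Finset.range K, avgToddLogCoeff k / ((k : ℝ) + 1) ≤ 2 := by
  have e : ∫ θ in (0 : ℝ)..Real.pi,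
      ∑ k ∈ Finset.range K, toddLogCoeff (Real.sin θ ^ 2) k / ((k : ℝ) + 1) =
      Real.pi * ∑ k ∈ Finset.range K, avgToddLogCoeff k / ((k : ℝ) + 1) := by
    rw [intervalIntegral.integral_finsetSum, Finset.mul_sum]
    · refine Finset.sum_congr rfl fun k _ => ?_
      rw [intervalIntegral.integral_div, integral_toddLogCoeff_sin_sq]
      ring
    · exact fun k _ => ((continuous_toddLogCoeff_sin_sq k).div_const _).intervalIntegrable _ _
  -- The bound 1 + s ≤ 2 is available only for s > 0, hence the open interval: sin θ vanishes at
  -- both ends.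
  have h := intervalIntegral.integral_mono_on_of_le_Ioo (μ := volume) Real.pi_pos.le
    (f := fun θ => ∑ k ∈ Finset.range K, toddLogCoeff (Real.sin θ ^ 2) k / ((k : ℝ) + 1))
    (g := fun _ => 2)
    ((continuous_finsetSum _ fun k _ =>
      (continuous_toddLogCoeff_sin_sq k).div_const _).intervalIntegrable _ _)
    (by simp) fun θ hθ => by
      have hs : 0 < Real.sin θ ^ 2 := by
        have := Real.sin_pos_of_mem_Ioo hθ
        positivity
      have h1 := Real.sin_sq_le_one θ
      have := sum_toddLogCoeff_div_le hs h1 K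
      linarith
  rw [e] at h
  simp only [intervalIntegral.integral_const, sub_zero, smul_eq_mul] at h
  exact le_of_mul_le_mul_left h Real.pi_pos

theorem summable_avgToddLogCoeff_div : Summable fun k => avgToddLogCoeff k / ((k : ℝ) + 1) :=
  summable_of_sum_range_le (fun k => div_nonneg (avgToddLogCoeff_nonneg k) (by positivity))
    sum_avgToddLogCoeff_div_le

theorem summable_avgBernoulliLogCoeff_bound :
    Summable fun k : ℕ => (avgToddLogCoeff k + 1 / 2 * (k : ℝ)⁻¹) * (1 / ((k : ℝ) + 1)) := by
  convert! summable_avgToddLogCoeff_div.add (summable_inv_mul_one_div_succ.mul_left (1 / 2)) using 1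
  ext k
  ring

theorem abs_avgBernoulliLogCoeff_le (k : ℕ) :
    |avgBernoulliLogCoeff k| ≤ avgToddLogCoeff k + 1 / 2 * (k : ℝ)⁻¹ := by
  have h2 := avgToddLogCoeff_nonneg k
  have h3 : 0 ≤ 1 / 2 * (k : ℝ)⁻¹ := by positivity
  rw [avgBernoulliLogCoeff_eq, abs_le]
  constructor <;> linarith

/-- For a nonincreasing sequence, the k-th term times the harmonic sum H_{k+1} is at most Σ_{j≤k}
u_j/(j+1) ≤ 2, and the harmonic sums diverge. -/
theorem tendsto_avgToddLogCoeff : Filter.Tendsto avgToddLogCoeff Filter.atTop (nhds 0) := by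
  have hanti : Antitone avgToddLogCoeff := antitone_nat_of_succ_le avgToddLogCoeff_succ_le
  have hb : ∀ k, avgToddLogCoeff k * ∑ j ∈ Finset.range (k + 1), 1 / ((j : ℝ) + 1) ≤ 2 := by
    intro k
    refine le_trans ?_ (sum_avgToddLogCoeff_div_le (k + 1))
    rw [Finset.mul_sum]
    refine Finset.sum_le_sum fun j hj => ?_
    rw [mul_one_div]
    have : avgToddLogCoeff k ≤ avgToddLogCoeff j :=
      hanti (Nat.lt_succ_iff.1 (Finset.mem_range.1 hj))
    gcongr
  have hH : Filter.Tendsto (fun k : ℕ => ∑ j ∈ Finset.range (k + 1), 1 / ((j : ℝ) + 1))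
      Filter.atTop Filter.atTop :=
    Real.tendsto_sum_range_one_div_nat_succ_atTop.comp (Filter.tendsto_add_atTop_nat 1)
  refine squeeze_zero avgToddLogCoeff_nonneg (fun k => ?_) (hH.const_div_atTop 2)
  have hpos : 0 < ∑ j ∈ Finset.range (k + 1), 1 / ((j : ℝ) + 1) :=
    Finset.sum_pos (fun j _ => by positivity) (by simp)
  rw [le_div_iff₀ hpos]
  exact hb k

theorem tendsto_avgBernoulliLogCoeff :
    Filter.Tendsto avgBernoulliLogCoeff Filter.atTop (nhds 0) := by
  have h := tendsto_avgToddLogCoeff.sub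
    ((tendsto_inv_atTop_nhds_zero_nat (𝕜 := ℝ)).const_mul (1 / 2))
  simp only [mul_zero, sub_zero] at h
  exact h.congr fun k => (avgBernoulliLogCoeff_eq k).symm

theorem integral_abs_bernoulliLogCoeff_sin_sq_le (k : ℕ) :
    ∫ θ in (0 : ℝ)..Real.pi, |bernoulliLogCoeff (Real.sin θ ^ 2) k| ≤
      Real.pi * (avgToddLogCoeff k + 1 / 2 * (k : ℝ)⁻¹) := by
  have e : ∫ θ in (0 : ℝ)..Real.pi,
      (toddLogCoeff (Real.sin θ ^ 2) k + Real.sin θ ^ 2 * (k : ℝ)⁻¹) =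
      Real.pi * (avgToddLogCoeff k + 1 / 2 * (k : ℝ)⁻¹) := by
    rw [intervalIntegral.integral_add ((continuous_toddLogCoeff_sin_sq k).intervalIntegrable _ _)
      ((by fun_prop : Continuous _).intervalIntegrable _ _), intervalIntegral.integral_mul_const,
      integral_sin_sq_zero_pi, integral_toddLogCoeff_sin_sq]
    ring
  rw [← e]
  exact intervalIntegral.integral_mono (μ := volume) Real.pi_pos.le
    ((continuous_bernoulliLogCoeff_sin_sq k).abs.intervalIntegrable _ _)
    (((continuous_toddLogCoeff_sin_sq k).add (by fun_prop)).intervalIntegrable _ _) fun θ =>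
    abs_bernoulliLogCoeff_le (sq_nonneg (Real.sin θ)) (Real.sin_sq_le_one θ) k

theorem summable_one_div_mul_sqrt (n : ℕ) :
    Summable fun m : ℕ => 1 / (((n : ℝ) + ((m : ℝ) + 1)) * √((n : ℝ) + ((m : ℝ) + 1))) := by
  have h : Summable fun m : ℕ => 1 / ((m : ℝ) ^ (3 / 2 : ℝ)) :=
    Real.summable_one_div_nat_rpow.2 (by norm_num)
  have h2 := (summable_nat_add_iff (n + 1)).2 h
  convert! h2 using 1
  ext m
  have e : ((m + (n + 1) : ℕ) : ℝ) = (n : ℝ) + ((m : ℝ) + 1) := by push_cast; ring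
  have hp : 0 < (n : ℝ) + ((m : ℝ) + 1) := by positivity
  rw [e, (by norm_num : (3 / 2 : ℝ) = 1 + 1 / 2), Real.rpow_add hp, Real.rpow_one,
    ← Real.sqrt_eq_rpow]

/-- The identity for fixed s is integrated over θ. `A` and `B` justify exchanging the integral with
the sums over k and m respectively. -/
theorem hasSum_avgBernoulliLogCoeff_mul_invFactorialTerm {n : ℕ} (hn : 1 ≤ n) :
    HasSum (fun k => avgBernoulliLogCoeff k * invFactorialTerm n k)
      (1 / (2 * √(n : ℝ)) *
        ∑' m : ℕ, 1 / (((n : ℝ) + ((m : ℝ) + 1)) * √((n : ℝ) + ((m : ℝ) + 1)))) := by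
  have hn1 : (1 : ℝ) ≤ n := by exact_mod_cast hn
  have hn0 : (0 : ℝ) < n := by linarith
  have hconv : ∀ f : ℝ → ℝ, ∫ θ in Set.Ioo 0 Real.pi, f θ = ∫ θ in (0 : ℝ)..Real.pi, f θ :=
    fun f => by
      rw [intervalIntegral.integral_of_le Real.pi_pos.le, integral_Ioc_eq_integral_Ioo]
  have hint : ∀ f : ℝ → ℝ, Continuous f → IntegrableOn f (Set.Ioo 0 Real.pi) := fun f hf =>
    hf.integrableOn_Icc.mono_set Set.Ioo_subset_Icc_self
  have A := hasSum_integral_of_summable_integral_norm (μ := volume.restrict (Set.Ioo 0 Real.pi))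
    (F := fun k θ => bernoulliLogCoeff (Real.sin θ ^ 2) k * invFactorialTerm n k)
    (fun k => hint _ ((continuous_bernoulliLogCoeff_sin_sq k).mul_const _)) (by
      refine Summable.of_nonneg_of_le (fun k => by positivity) (fun k => ?_)
        (summable_avgBernoulliLogCoeff_bound.mul_left Real.pi)
      simp only [norm_mul]
      rw [hconv, intervalIntegral.integral_mul_const,
        Real.norm_of_nonneg (invFactorialTerm_pos hn0 k).le, ← mul_assoc]
      have := integral_abs_bernoulliLogCoeff_sin_sq_le k
      have h2 := avgToddLogCoeff_nonneg k
      exact mul_le_mul this (invFactorialTerm_le hn1 k) (invFactorialTerm_pos hn0 k).le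
        (by positivity))
  have v : ∀ m : ℕ, ∫ θ in (0 : ℝ)..Real.pi,
      Real.sin θ ^ 2 / ((n : ℝ) + ((m : ℝ) + 1) * Real.sin θ ^ 2) ^ 2 =
        Real.pi * (1 / (2 * √(n : ℝ))) *
          (1 / (((n : ℝ) + ((m : ℝ) + 1)) * √((n : ℝ) + ((m : ℝ) + 1)))) := by
    intro m
    rw [integral_sin_sq_div_sq hn0 (by positivity)]
    field_simp
  have B := hasSum_integral_of_summable_integral_norm (μ := volume.restrict (Set.Ioo 0 Real.pi))
    (F := fun (m : ℕ) θ => Real.sin θ ^ 2 / ((n : ℝ) + ((m : ℝ) + 1) * Real.sin θ ^ 2) ^ 2)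
    (fun m => hint _ (Continuous.div (by fun_prop) (by fun_prop) fun θ => by positivity)) (by
      convert! (summable_one_div_mul_sqrt n).mul_left (Real.pi * (1 / (2 * √(n : ℝ)))) using 1
      ext m
      rw [← v, ← hconv]
      congr 1
      ext θ
      exact Real.norm_of_nonneg (by positivity))
  have AB : ∫ θ in Set.Ioo 0 Real.pi,
      (∑' k, bernoulliLogCoeff (Real.sin θ ^ 2) k * invFactorialTerm n k) =
      ∫ θ in Set.Ioo 0 Real.pi,
        ∑' m : ℕ, Real.sin θ ^ 2 / ((n : ℝ) + ((m : ℝ) + 1) * Real.sin θ ^ 2) ^ 2 := by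
    refine setIntegral_congr_fun measurableSet_Ioo fun θ hθ => ?_
    have hs : 0 < Real.sin θ ^ 2 := by
      have := Real.sin_pos_of_mem_Ioo hθ
      positivity
    exact (hasSum_bernoulliLogCoeff_mul_invFactorialTerm hs (Real.sin_sq_le_one θ) hn1).tsum_eq
  rw [AB, ← B.tsum_eq] at A
  simp only [hconv, v, intervalIntegral.integral_mul_const, integral_bernoulliLogCoeff_sin_sq,
    tsum_mul_left] at A
  have := A.mul_left (1 / Real.pi)
  convert! this using 1
  · ext k
    field_simp
  · field_simp

/-! ### Summation by parts and the coefficients a_k, b_k -/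

/-- The coefficients in `x` of the derivative of the averaged series, as a function of
`-log (1 - x)`. -/
noncomputable def avgBernoulliLogDerivCoeff (k : ℕ) : ℝ :=
  ((k : ℝ) + 1) * avgBernoulliLogCoeff (k + 1) - k * avgBernoulliLogCoeff k

/-- The left side is the coefficient of (1-x) d/dx. This operator is d/dy for y = -log(1-x), so it
shifts the exponential generating function of h. -/
theorem stirlingTransform_succ (h : ℕ → ℝ) (k : ℕ) :
    ((k : ℝ) + 1) * stirlingTransform h (k + 1) - k * stirlingTransform h k =
      stirlingTransform (fun l => h (l + 1)) k := by
  have n0 : (k ! : ℝ) ≠ 0 := by positivity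
  have n1 : (k : ℝ) + 1 ≠ 0 := by positivity
  have e : ∑ l ∈ Finset.range (k + 1 + 1), (Nat.stirlingFirst (k + 1) l : ℝ) * h l =
      k * ∑ l ∈ Finset.range (k + 1), (Nat.stirlingFirst k l : ℝ) * h l +
        ∑ l ∈ Finset.range (k + 1), (Nat.stirlingFirst k l : ℝ) * h (l + 1) := by
    rw [Finset.sum_range_succ']
    simp only [Nat.stirlingFirst_succ_succ, Nat.stirlingFirst_succ_zero, Nat.cast_zero, zero_mul,
      add_zero]
    have e2 : (k : ℝ) * ∑ l ∈ Finset.range (k + 1), (Nat.stirlingFirst k l : ℝ) * h l =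
        k * ∑ l ∈ Finset.range (k + 1), (Nat.stirlingFirst k (l + 1) : ℝ) * h (l + 1) := by
      rw [Finset.sum_range_succ', Finset.sum_range_succ _ k,
        Nat.stirlingFirst_eq_zero_of_lt (Nat.lt_succ_self k)]
      rcases k with _ | k <;> simp
    rw [e2, Finset.mul_sum, ← Finset.sum_add_distrib]
    refine Finset.sum_congr rfl fun l _ => ?_
    push_cast
    ring
  unfold stirlingTransform
  rw [e, Nat.factorial_succ]
  push_cast
  field_simp
  ring

theorem sum_Icc_stirlingFirst_mul (h : ℕ → ℝ) (k : ℕ) :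
    ∑ l ∈ Finset.Icc 1 (k + 1), (Nat.stirlingFirst (k + 1) l : ℝ) * h l =
      ((k + 1)! : ℝ) * stirlingTransform h (k + 1) := by
  have n0 : ((k + 1)! : ℝ) ≠ 0 := by positivity
  rw [stirlingTransform, mul_div_cancel₀ _ n0, Finset.range_eq_Ico,
    Finset.sum_eq_sum_Ico_succ_bot (by omega)]
  simp
  rfl

theorem neg_one_pow_mul_stirlingFirstSigned (k l : ℕ) :
    (-1 : ℝ) ^ (k + 1) * ((-1) ^ l * (stirlingFirstSigned k l : ℝ)) = -Nat.stirlingFirst k l := by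
  have h : ∀ j : ℕ, ((-1 : ℝ) ^ j) * (-1) ^ j = 1 := fun j => by rw [← mul_pow]; simp
  rw [stirlingFirstSigned]
  push_cast
  rw [pow_add, pow_add]
  linear_combination (-(Nat.stirlingFirst k l : ℝ) * (-1) ^ l * (-1) ^ l) * h k -
    (Nat.stirlingFirst k l : ℝ) * h l

theorem zetaThreeHalvesCoeffB_succ (k : ℕ) :
    (zetaThreeHalvesCoeffB (k + 1) : ℝ) = -(((k + 1)! : ℝ) * avgBernoulliLogCoeff (k + 1)) := by
  rw [avgBernoulliLogCoeff, ← sum_Icc_stirlingFirst_mul, zetaThreeHalvesCoeffB,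
    ← Finset.sum_neg_distrib]
  push_cast
  rw [Finset.mul_sum]
  refine Finset.sum_congr rfl fun l _ => ?_
  linear_combination ((bernoulli l : ℝ) * (((2 * l - 1)‼ : ℝ) / (2 ^ l * (l ! : ℝ)))) *
    neg_one_pow_mul_stirlingFirstSigned (k + 1) l

theorem zetaThreeHalvesCoeffA_succ (k : ℕ) :
    (zetaThreeHalvesCoeffA (k + 1) : ℝ) =
      -(((k + 1)! : ℝ) * avgBernoulliLogDerivCoeff (k + 1)) := by
  rw [avgBernoulliLogDerivCoeff, avgBernoulliLogCoeff, avgBernoulliLogCoeff,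
    stirlingTransform_succ, ← sum_Icc_stirlingFirst_mul, zetaThreeHalvesCoeffA,
    ← Finset.sum_neg_distrib]
  push_cast
  rw [Finset.mul_sum]
  refine Finset.sum_congr rfl fun l _ => ?_
  have e : 2 * (l + 1) - 1 = 2 * l + 1 := by omega
  rw [e]
  linear_combination ((bernoulli (l + 1) : ℝ) *
    (((2 * l + 1)‼ : ℝ) / (2 ^ (l + 1) * ((l + 1)! : ℝ)))) *
    neg_one_pow_mul_stirlingFirstSigned (k + 1) l

theorem mul_prod_Icc_add (a : ℝ) (k : ℕ) :
    a * ∏ i ∈ Finset.Icc 1 k, (a + (i : ℝ)) = ∏ i ∈ Finset.range (k + 1), (a + (i : ℝ)) := by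
  induction k with
  | zero => simp
  | succ k ih =>
    rw [Finset.prod_Icc_succ_top (by omega), ← mul_assoc, ih, Finset.prod_range_succ _ (k + 1)]

theorem zetaThreeHalvesTermA_succ (n k : ℕ) :
    zetaThreeHalvesTermA n (k + 1) =
      -(avgBernoulliLogDerivCoeff (k + 1) * invFactorialTerm n (k + 1)) := by
  rw [zetaThreeHalvesTermA, mul_prod_Icc_add, zetaThreeHalvesCoeffA_succ, invFactorialTerm]
  ring

theorem zetaThreeHalvesTermB_succ {n : ℕ} (hn : 1 ≤ n) (k : ℕ) :
    zetaThreeHalvesTermB n (k + 1) =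
      -√(n : ℝ) * (avgBernoulliLogCoeff (k + 1) * invFactorialTerm n (k + 1)) := by
  have hn0 : (0 : ℝ) < n := by exact_mod_cast hn
  have hs : 0 < √(n : ℝ) := Real.sqrt_pos.2 hn0
  have hsq : √(n : ℝ) * √(n : ℝ) = n := Real.mul_self_sqrt hn0.le
  have hP : 0 < ∏ i ∈ Finset.Icc 1 (k + 1), ((n : ℝ) + (i : ℝ)) :=
    Finset.prod_pos fun i _ => by positivity
  rw [zetaThreeHalvesTermB, zetaThreeHalvesCoeffB_succ, invFactorialTerm, ← mul_prod_Icc_add]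
  nth_rewrite 4 [← hsq]
  field_simp

/-- After bounding the inverse factorial by 1/(k+2), the term splits into a difference of
consecutive averages and an average over k+2. The differences are summable by telescoping of the
monotone Todd averages plus Σ 1/(k(k+1)). -/
theorem summable_avgBernoulliLogDerivCoeff_mul {a : ℝ} (ha : 1 ≤ a) :
    Summable fun k => avgBernoulliLogDerivCoeff (k + 1) * invFactorialTerm a (k + 1) := by
  have s1 : Summable fun k => avgToddLogCoeff (k + 1) - avgToddLogCoeff (k + 2) := by
    refine summable_of_sum_range_le (c := avgToddLogCoeff 1)
      (fun k => sub_nonneg.2 (avgToddLogCoeff_succ_le _)) fun K => ?_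
    rw [Finset.sum_range_sub' (fun k => avgToddLogCoeff (k + 1))]
    linarith [avgToddLogCoeff_nonneg (K + 1)]
  have s2 := ((summable_nat_add_iff 1).2 summable_inv_mul_one_div_succ).mul_left (1 / 2)
  have s3 := (summable_nat_add_iff 1).2 summable_avgBernoulliLogCoeff_bound
  refine Summable.of_norm_bounded ((s1.add s2).add s3) fun k => ?_
  have hW := invFactorialTerm_le ha (k + 1)
  have hW0 := (invFactorialTerm_pos (by linarith : 0 < a) (k + 1)).le
  have hd : |avgBernoulliLogCoeff (k + 2) - avgBernoulliLogCoeff (k + 1)| ≤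
      (avgToddLogCoeff (k + 1) - avgToddLogCoeff (k + 2)) +
        1 / 2 * (((k + 1 : ℕ) : ℝ)⁻¹ * (1 / (((k + 1 : ℕ) : ℝ) + 1))) := by
    have h1 := avgToddLogCoeff_succ_le (k + 1)
    have h2 : 1 / 2 * (((k + 1 : ℕ) : ℝ)⁻¹ * (1 / (((k + 1 : ℕ) : ℝ) + 1))) =
        1 / 2 * ((k + 1 : ℕ) : ℝ)⁻¹ - 1 / 2 * ((k + 2 : ℕ) : ℝ)⁻¹ := by
      push_cast
      field_simp
      ring
    have h3 : 0 ≤ 1 / 2 * (((k + 1 : ℕ) : ℝ)⁻¹ * (1 / (((k + 1 : ℕ) : ℝ) + 1))) := by positivity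
    rw [avgBernoulliLogCoeff_eq, avgBernoulliLogCoeff_eq, abs_le]
    constructor <;> linarith
  have hb := abs_avgBernoulliLogCoeff_le (k + 1)
  have hk : (0 : ℝ) < ((k + 1 : ℕ) : ℝ) + 1 := by positivity
  have e : avgBernoulliLogDerivCoeff (k + 1) * (1 / (((k + 1 : ℕ) : ℝ) + 1)) =
      (avgBernoulliLogCoeff (k + 2) - avgBernoulliLogCoeff (k + 1)) +
        avgBernoulliLogCoeff (k + 1) * (1 / (((k + 1 : ℕ) : ℝ) + 1)) := by
    rw [avgBernoulliLogDerivCoeff]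
    field_simp
    ring
  calc ‖avgBernoulliLogDerivCoeff (k + 1) * invFactorialTerm a (k + 1)‖
      ≤ |avgBernoulliLogDerivCoeff (k + 1)| * (1 / (((k + 1 : ℕ) : ℝ) + 1)) := by
        rw [norm_mul, Real.norm_eq_abs, Real.norm_of_nonneg hW0]
        exact mul_le_mul_of_nonneg_left hW (abs_nonneg _)
    _ = |avgBernoulliLogDerivCoeff (k + 1) * (1 / (((k + 1 : ℕ) : ℝ) + 1))| := by
        rw [abs_mul, abs_of_pos (by positivity : 0 < 1 / (((k + 1 : ℕ) : ℝ) + 1))]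
    _ ≤ |avgBernoulliLogCoeff (k + 2) - avgBernoulliLogCoeff (k + 1)| +
        |avgBernoulliLogCoeff (k + 1)| * (1 / (((k + 1 : ℕ) : ℝ) + 1)) := by
        rw [e]
        refine (abs_add_le _ _).trans_eq ?_
        rw [abs_mul (avgBernoulliLogCoeff (k + 1)),
          abs_of_pos (by positivity : 0 < 1 / (((k + 1 : ℕ) : ℝ) + 1))]
    _ ≤ _ := add_le_add hd (mul_le_mul_of_nonneg_right hb (by positivity))

theorem sum_avgBernoulliLogDerivCoeff_mul {a : ℝ} (ha : 0 < a) (K : ℕ) :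
    ∑ k ∈ Finset.range K, avgBernoulliLogDerivCoeff (k + 1) * invFactorialTerm a (k + 1) =
      a * ∑ k ∈ Finset.range K, avgBernoulliLogCoeff (k + 1) * invFactorialTerm a (k + 1) -
        avgBernoulliLogCoeff 1 / a +
        (K + 1) * invFactorialTerm a K * avgBernoulliLogCoeff (K + 1) := by
  induction K with
  | zero => simp [invFactorialTerm_zero]; ring
  | succ K ih =>
    rw [Finset.sum_range_succ, ih, Finset.sum_range_succ, avgBernoulliLogDerivCoeff]
    push_cast
    linear_combination avgBernoulliLogCoeff (K + 1) * invFactorialTerm_succ ha K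

/-- In the Abel summation formula the boundary term vanishes in the limit: (K+1) `invFactorialTerm a
K` ≤ 1 and the averaged coefficients tend to 0. -/
theorem hasSum_avgBernoulliLogDerivCoeff_mul {a S : ℝ} (ha : 1 ≤ a)
    (hS : HasSum (fun k => avgBernoulliLogCoeff (k + 1) * invFactorialTerm a (k + 1)) S) :
    HasSum (fun k => avgBernoulliLogDerivCoeff (k + 1) * invFactorialTerm a (k + 1))
      (a * S - avgBernoulliLogCoeff 1 / a) := by
  have h0 : 0 < a := by linarith
  rw [(summable_avgBernoulliLogDerivCoeff_mul ha).hasSum_iff_tendsto_nat]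
  simp only [sum_avgBernoulliLogDerivCoeff_mul h0]
  have hb : Filter.Tendsto
      (fun K : ℕ => ((K : ℝ) + 1) * invFactorialTerm a K * avgBernoulliLogCoeff (K + 1))
      Filter.atTop (nhds 0) := by
    refine squeeze_zero_norm (fun K => ?_)
      ((tendsto_avgBernoulliLogCoeff.comp (Filter.tendsto_add_atTop_nat 1)).norm.trans (by simp))
    rw [norm_mul]
    refine mul_le_of_le_one_left (norm_nonneg _) ?_
    have h1 := invFactorialTerm_le ha K
    have h2 := (invFactorialTerm_pos h0 K).le
    rw [Real.norm_of_nonneg (by positivity)]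
    rw [le_div_iff₀ (by positivity)] at h1
    linarith
  have := ((hS.tendsto_sum_nat.const_mul a).sub_const (avgBernoulliLogCoeff 1 / a)).add hb
  rwa [add_zero] at this

/-! ### Assembly with ζ(3/2) -/

theorem avgBernoulliLogCoeff_zero : avgBernoulliLogCoeff 0 = 1 := by
  simp [avgBernoulliLogCoeff, stirlingTransform]

theorem avgBernoulliLogCoeff_one : avgBernoulliLogCoeff 1 = -(1 / 4) := by
  simp [avgBernoulliLogCoeff, stirlingTransform, Finset.sum_range_succ, Nat.stirlingFirst]
  norm_num

theorem riemannZeta_three_halves :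
    riemannZeta (3 / 2) = ((∑' k : ℕ, 1 / (((k : ℝ) + 1) * √((k : ℝ) + 1)) : ℝ) : ℂ) := by
  rw [zeta_eq_tsum_one_div_nat_add_one_cpow (by norm_num), Complex.ofReal_tsum]
  refine tsum_congr fun k => ?_
  have hp : 0 < (k : ℝ) + 1 := by positivity
  have e : ((k : ℝ) + 1) * √((k : ℝ) + 1) = ((k : ℝ) + 1) ^ (3 / 2 : ℝ) := by
    rw [(by norm_num : (3 / 2 : ℝ) = 1 + 1 / 2), Real.rpow_add hp, Real.rpow_one,
      ← Real.sqrt_eq_rpow]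
  rw [e, Complex.ofReal_div, Complex.ofReal_cpow hp.le]
  push_cast
  rfl

theorem sum_Icc_add_tsum (n : ℕ) :
    ∑ k ∈ Finset.Icc 1 n, 1 / ((k : ℝ) * √(k : ℝ)) +
      ∑' m : ℕ, 1 / (((n : ℝ) + ((m : ℝ) + 1)) * √((n : ℝ) + ((m : ℝ) + 1))) =
      ∑' k : ℕ, 1 / (((k : ℝ) + 1) * √((k : ℝ) + 1)) := by
  have hs : Summable fun k : ℕ => 1 / (((k : ℝ) + 1) * √((k : ℝ) + 1)) := by
    simpa using summable_one_div_mul_sqrt 0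
  rw [← hs.sum_add_tsum_nat_add n]
  congr 1
  · clear hs
    induction n with
    | zero => simp
    | succ n ih =>
      rw [Finset.sum_Icc_succ_top (by omega), ih, Finset.sum_range_succ]
      push_cast
      rfl
  · refine tsum_congr fun m => ?_
    have : ((m + n : ℕ) : ℝ) + 1 = (n : ℝ) + ((m : ℝ) + 1) := by push_cast; ring
    rw [this]

theorem bernoulli_three_four_five : bernoulli 3 = 0 ∧ bernoulli 4 = -1 / 30 ∧ bernoulli 5 = 0 := by
  refine ⟨?_, ?_, ?_⟩
  · rw [bernoulli_eq_bernoulli'_of_ne_one (by norm_num), bernoulli'_three]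
  · rw [bernoulli_eq_bernoulli'_of_ne_one (by norm_num), bernoulli'_four]
  · rw [bernoulli_eq_bernoulli'_of_ne_one (by norm_num)]
    exact bernoulli'_eq_zero_of_odd (by decide) (by norm_num)

theorem mainTheorem7 :
    (∀ n : ℕ, 1 ≤ n →
      Summable (fun j : ℕ => zetaThreeHalvesTermA n (j + 1)) ∧
      ((∑ k ∈ Finset.Icc 1 n, 1 / ((k : ℝ) * √(k : ℝ)) : ℝ) : ℂ) =
        riemannZeta (3 / 2) +
          ((-(2 / √(n : ℝ)) + 1 / (2 * (n : ℝ) * √(n : ℝ)) +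
            2 / √(n : ℝ) * ∑' j : ℕ, zetaThreeHalvesTermA n (j + 1) : ℝ) : ℂ)) ∧
    (2 * zetaThreeHalvesCoeffA 1 = -(1 / 8) ∧ 2 * zetaThreeHalvesCoeffA 2 = -(1 / 8) ∧
      2 * zetaThreeHalvesCoeffA 3 = -(89 / 384) ∧ 2 * zetaThreeHalvesCoeffA 4 = -(41 / 64)) ∧
    (∀ n : ℕ, 1 ≤ n →
      Summable (fun j : ℕ => zetaThreeHalvesTermB n (j + 1)) ∧
      ((∑ k ∈ Finset.Icc 1 n, 1 / ((k : ℝ) * √(k : ℝ)) : ℝ) : ℂ) =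
        riemannZeta (3 / 2) +
          ((-(2 / √(n : ℝ)) +
            2 * ∑' j : ℕ, zetaThreeHalvesTermB n (j + 1) : ℝ) : ℂ)) ∧
    (2 * zetaThreeHalvesCoeffB 1 = 1 / 2 ∧ 2 * zetaThreeHalvesCoeffB 2 = 3 / 8 ∧
      2 * zetaThreeHalvesCoeffB 3 = 5 / 8 ∧ 2 * zetaThreeHalvesCoeffB 4 = 631 / 384) := by
  have key : ∀ n : ℕ, 1 ≤ n → ∃ S : ℝ,
      HasSum (fun k => avgBernoulliLogCoeff (k + 1) * invFactorialTerm n (k + 1)) S ∧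
      ((∑ k ∈ Finset.Icc 1 n, 1 / ((k : ℝ) * √(k : ℝ)) : ℝ) : ℂ) =
        riemannZeta (3 / 2) + ((-(2 / √(n : ℝ)) - 2 * √(n : ℝ) * S : ℝ) : ℂ) := by
    intro n hn
    have hn0 : (0 : ℝ) < n := by exact_mod_cast hn
    have hs : 0 < √(n : ℝ) := Real.sqrt_pos.2 hn0
    have hsq : √(n : ℝ) ^ 2 = n := Real.sq_sqrt hn0.le
    have h := hasSum_avgBernoulliLogCoeff_mul_invFactorialTerm hn
    -- The k = 0 term equals 1/n; multiplied by 2√n it produces the 2/√n of the statement.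
    rw [← hasSum_nat_add_iff' 1] at h
    refine ⟨_, h, ?_⟩
    rw [riemannZeta_three_halves, ← sum_Icc_add_tsum n, ← Complex.ofReal_add]
    congr 1
    simp only [Finset.range_one, Finset.sum_singleton, avgBernoulliLogCoeff_zero,
      invFactorialTerm_zero]
    rw [← hsq, Real.sqrt_sq hs.le]
    field_simp
    ring
  obtain ⟨b3, b4, b5⟩ := bernoulli_three_four_five
  refine ⟨fun n hn => ?_, ?_, fun n hn => ?_, ?_⟩
  · obtain ⟨S, hS, hz⟩ := key n hn
    have hn1 : (1 : ℝ) ≤ n := by exact_mod_cast hn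
    have hn0 : (0 : ℝ) < n := by linarith
    have hs : 0 < √(n : ℝ) := Real.sqrt_pos.2 hn0
    have hsq : √(n : ℝ) ^ 2 = n := Real.sq_sqrt hn0.le
    have hA := (hasSum_avgBernoulliLogDerivCoeff_mul hn1 hS).neg
    simp only [← zetaThreeHalvesTermA_succ] at hA
    refine ⟨hA.summable, ?_⟩
    -- The boundary value -1/4 at k = 1 accounts for the extra term 1/(2n√n) of the first formula.
    rw [hz, hA.tsum_eq, avgBernoulliLogCoeff_one]
    congr 2
    field_simp
    linear_combination (-16 * (n : ℝ) * S) * hsq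
  · refine ⟨?_, ?_, ?_, ?_⟩ <;>
    simp [zetaThreeHalvesCoeffA, stirlingFirstSigned, Finset.sum_Icc_succ_top, Nat.stirlingFirst,
      Nat.doubleFactorial, Nat.factorial, b3, b4, b5, bernoulli_two] <;>
    norm_num
  · obtain ⟨S, hS, hz⟩ := key n hn
    have hB := hS.mul_left (-√(n : ℝ))
    simp only [← zetaThreeHalvesTermB_succ hn] at hB
    refine ⟨hB.summable, ?_⟩
    rw [hz, hB.tsum_eq]
    congr 2
    ring
  · refine ⟨?_, ?_, ?_, ?_⟩ <;>
    simp [zetaThreeHalvesCoeffB, stirlingFirstSigned, Finset.sum_Icc_succ_top, Nat.stirlingFirst,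
      Nat.doubleFactorial, Nat.factorial, b3, b4, bernoulli_two] <;>
    norm_num
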